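/- **Setting.** A *metric tree* $J$ is a tree (connected graph without circuits) whose edges carry positive lengths; $\rho(a,b)$ is the sum of the lengths of the edges on the path from $a$ to $b$. Suppose that $J$ is *perfect* (every vertex lies on at least three edges) and *locally finite* (every vertex lies on finitely many edges, and $\{b:\rho(a,b)<C\}$ is finite for every vertex $a$ and every $C$), and that a group $\Gamma$ acts on the vertices of $J$ by $\rho$-isometries. Let $0<\lambda<1$, and fix a vertex $\xi$. *Hilbert space.* $\mathcal H_\lambda(J)$ is the real Hilbert space spanned (topologically) by vectors $e_a$, $a\in \mathrm{Vert}(J)$, with $\langle e_a,e_b\rangle=\lambda^{\rho(a,b)}$. Put $f_a=\lambda^{-\rho(\xi,a)}e_a$. *Hierarchomorphisms.* A subtree is *right* if only finitely many edges lead out of it. $\mathrm{Hier}^\circ(J,\Gamma)$ is the group of bijections $g$ of $\mathrm{Vert}(J)$ for which there are a finite partition of $\mathrm{Vert}(J)$ into right subtrees $S_1,\dots,S_k$ and elements $\gamma_1,\dots,\gamma_k\in\Gamma$ with $g(a)=\gamma_j a$ for $a\in S_j$. The *absolute* $\mathrm{Abs}(J)$ is the set of infinite paths $a_1,a_2,\dots$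 (with distinct vertices) modulo coincidence of tails up to a shift. A *branch* is a subtree with exactly one edge leading out of it; the *root* of the branch is the endpoint of this edge in it. The topology of $\mathrm{Abs}(J)$ is generated by the balls $B[S]$, i.e. the absolutes of the branches $S$. Each $g\in\mathrm{Hier}^\circ(J,\Gamma)$ maps tails of infinite paths to infinite paths, and so induces a transformation $\widetilde g$ of $\mathrm{Abs}(J)$; these form the group $\mathrm{Hier}(J,\Gamma)$. The *pseudoderivative* $n(g,\omega)$ is the eventual constant value of $\rho(\xi,a_M)-\rho(\xi,ga_M)$ along any path $a_1,a_2,\dots$ leading to $\omega\in\mathrm{Abs}(J)$. *Boundary space.* A finite subtree $R$ is *complete* if each $a\in R$ has either all its neighbours in $R$ or exactly one neighbour in $R$; $\partial R$ is the set of vertices of the second kind, and we require $\xi\in R\setminus\partial R$. Fix complete subtrees $R_1\subset R_2\subset\cdots$ with $\bigcup R_j=J$. For a finite real-valued Borel measure (charge) $\mu$ on $\mathrm{Abs}(J)$ put $\Psi[\mu|R]=\sum_{u\in\partial R}\mu(B[S_u])f_u$, where $S_u$ is the branch with root $u$ not containing $\xi$. $\mathcal E_\lambda(J)$ is the set of those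 $\mu$ for which $\lim_j\|\Psi[\mu|R_j]\|$ exists and is finite; for these, $\Psi[\mu]=\lim_j\Psi[\mu|R_j]$. Let $\mathfrak E_\lambda\subset\mathcal H_\lambda(J)$ be the set of all limits $\Psi[\mu]$, $\mu\in\mathcal E_\lambda(J)$, and $\overline{\mathfrak E}_\lambda$ its closure. **Proposition 6.1.** The group $\mathrm{Hier}^\circ(J,\Gamma)$ acts on $\mathcal H_\lambda(J)$ by bounded operators $U(g)$ with $U(g)e_a=e_{ga}$, and: (a) $\overline{\mathfrak E}_\lambda$ is invariant under all $U(g)$, $g\in \mathrm{Hier}^\circ(J,\Gamma)$. (b) If $\widetilde g=\widetilde h$, then $U(g)$ and $U(h)$ have the same restriction to $\overline{\mathfrak E}_\lambda$, and $n(g,\cdot)=n(h,\cdot)$. (c) For $g\in\mathrm{Hier}^\circ(J,\Gamma)$ and a charge $\mu$ let $T_\lambda(g)\mu$ be the measure $$T_\lambda(g)\mu(\omega)=\lambda^{n(g^{-1},\omega)}\cdot\mu(g^{-1}\omega),$$ i.e. the charge with density $\lambda^{n(g^{-1},\cdot)}$ with respect to the image $A\mapsto\mu(\widetilde g^{-1}A)$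 of $\mu$ under $\widetilde g$. Then $T_\lambda(g)\mu\in\mathcal E_\lambda(J)$ for all $\mu\in\mathcal E_\lambda(J)$, and the limits $\Psi[\mu]$ and $\Psi[T_\lambda(g)\mu]$ exist and satisfy $U(g)\Psi[\mu]=\Psi[T_\lambda(g)\mu]$. Equivalently, $U(g^{-1})$ corresponds to $T_\lambda(g^{-1})\mu(\omega)=\lambda^{n(g,\omega)}\cdot\mu(g\omega)$, where $\mu(g\omega)$ is the charge $A\mapsto\mu(\widetilde gA)$. -/

import Mathlib

open Set Filter Topology MeasureTheory

noncomputable section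

/-- A metric tree with vertex set `V`: a simplicial tree whose edges carry positive lengths. -/
structure MetricTree (V : Type*) where
  graph : SimpleGraph V
  isTree : graph.IsTree
  len : Sym2 V → ℝ
  len_pos : ∀ e ∈ graph.edgeSet, 0 < len e

namespace MetricTree

variable {V : Type*} (J : MetricTree V)

/-- The unique way (path) from `a` to `b`. -/
def way (a b : V) : J.graph.Walk a b := (J.isTree.existsUnique_path a b).choose

/-- The distance: the sum of the lengths of the edges of the way from `a` to `b`. -/
def rho (a b : V) : ℝ := ((J.way a b).edges.map J.len).sum

/-- Every vertex belongs to at least three edges. -/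
def IsPerfect : Prop := ∀ a, 3 ≤ (J.graph.neighborSet a).encard

/-- Every vertex belongs to finitely many edges, and every set `{b | rho a b < C}` is finite. -/
def IsLocallyFinite : Prop :=
  (∀ a, (J.graph.neighborSet a).Finite) ∧ ∀ (a : V) (C : ℝ), {b | J.rho a b < C}.Finite

/-! Basic facts on ways and distances. -/

lemma way_isPath (a b : V) : (J.way a b).IsPath :=
  (J.isTree.existsUnique_path a b).choose_spec.1

lemma way_unique {a b : V} {p : J.graph.Walk a b} (hp : p.IsPath) : p = J.way a b :=
  (J.isTree.existsUnique_path a b).unique hp (J.way_isPath a b)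

lemma rho_eq {a b : V} {p : J.graph.Walk a b} (hp : p.IsPath) :
    J.rho a b = (p.edges.map J.len).sum := by
  rw [J.way_unique hp]; rfl

lemma rho_self (a : V) : J.rho a a = 0 := by
  rw [J.rho_eq (p := SimpleGraph.Walk.nil) SimpleGraph.Walk.IsPath.nil]; simp

lemma rho_comm (a b : V) : J.rho a b = J.rho b a := by
  rw [J.rho_eq (J.way_isPath b a).reverse]
  simp [rho, SimpleGraph.Walk.edges_reverse]

lemma rho_cons {a b c : V} (h : J.graph.Adj c a) {p : J.graph.Walk a b} (hp : p.IsPath)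
    (hc : c ∉ p.support) : J.rho c b = J.len s(c, a) + J.rho a b := by
  rw [J.rho_eq (hp.cons (h := h) hc), J.rho_eq hp]; simp

lemma rho_adj {a b : V} (h : J.graph.Adj a b) : J.rho a b = J.len s(a, b) := by
  rw [J.rho_cons h (p := SimpleGraph.Walk.nil) SimpleGraph.Walk.IsPath.nil (by simpa using h.ne),
    rho_self, add_zero]

lemma rho_pos {a b : V} (h : a ≠ b) : 0 < J.rho a b := by
  have hp := J.way_isPath a b
  unfold rho
  generalize J.way a b = p at hp
  cases p with
  | nil => exact absurd rfl h
  | cons hadj q =>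
    simp only [SimpleGraph.Walk.edges_cons, List.map_cons, List.sum_cons]
    have h1 := J.len_pos _ ((SimpleGraph.mem_edgeSet _).2 hadj)
    have h2 : 0 ≤ (q.edges.map J.len).sum := by
      apply List.sum_nonneg
      intro x hx
      obtain ⟨e, he, rfl⟩ := List.mem_map.1 hx
      exact (J.len_pos e (q.edges_subset_edgeSet he)).le
    linarith

lemma rho_eq_zero {a b : V} (h : J.rho a b = 0) : a = b := by
  by_contra hne
  exact (J.rho_pos hne).ne' h

/-- Either `c` lies beyond its neighbour `b` when seen from `a`, or `b` lies beyond `c`. -/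
lemma rho_step (a : V) {b c : V} (h : J.graph.Adj b c) :
    J.rho a c = J.rho a b + J.len s(b, c) ∨ J.rho a b = J.rho a c + J.len s(b, c) := by
  classical
  by_cases hc : c ∈ (J.way b a).support
  · right
    have hb : b ∉ (J.way c a).support := by
      intro hb
      have hp := J.way_isPath b a
      have e : (J.way b a).dropUntil c hc = J.way c a := J.way_unique (hp.dropUntil hc)
      have l1 := congrArg SimpleGraph.Walk.length e
      have e2 : (J.way c a).dropUntil b hb = J.way b a :=
        J.way_unique ((J.way_isPath c a).dropUntil hb)
      have l2 := congrArg SimpleGraph.Walk.length e2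
      have t1 := congrArg SimpleGraph.Walk.length ((J.way b a).take_spec hc)
      have t2 := congrArg SimpleGraph.Walk.length ((J.way c a).take_spec hb)
      rw [SimpleGraph.Walk.length_append] at t1 t2
      have : ((J.way b a).takeUntil c hc).length = 0 := by omega
      exact h.ne (SimpleGraph.Walk.eq_of_length_eq_zero this)
    rw [J.rho_comm a b, J.rho_comm a c, J.rho_cons h (J.way_isPath c a) hb, add_comm]
  · left
    rw [J.rho_comm a b, J.rho_comm a c, J.rho_cons h.symm (J.way_isPath b a) hc, add_comm,
      Sym2.eq_swap]

lemma rho_split {a b c : V} (hc : c ∈ (J.way a b).support) :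
    J.rho a b = J.rho a c + J.rho c b := by
  classical
  have hp := J.way_isPath a b
  rw [J.rho_eq (hp.takeUntil hc), J.rho_eq (hp.dropUntil hc), ← List.sum_append, ← List.map_append,
    ← SimpleGraph.Walk.edges_append, SimpleGraph.Walk.take_spec]
  rfl

/-- The edges are determined by the metric. -/
lemma adj_iff {a b : V} : J.graph.Adj a b ↔
    a ≠ b ∧ ∀ c, J.rho a b = J.rho a c + J.rho c b → c = a ∨ c = b := by
  constructor
  · intro h
    refine ⟨h.ne, fun c hc => ?_⟩
    have h0 := J.rho_adj h
    rcases J.rho_step c h with h1 | h1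
    · left
      have : J.rho a c = 0 := by rw [J.rho_comm c a] at h1; linarith
      exact (J.rho_eq_zero this).symm
    · right
      have : J.rho c b = 0 := by rw [J.rho_comm c a] at h1; linarith
      exact J.rho_eq_zero this
  · rintro ⟨hne, h⟩
    have hp := J.way_isPath a b
    have hs := fun c => J.rho_split (a := a) (b := b) (c := c)
    generalize J.way a b = p at hp hs
    cases p with
    | nil => exact absurd rfl hne
    | @cons _ c _ hadj q =>
      rcases h c (hs c (by simp)) with rfl | rfl
      · exact absurd rfl hadj.ne
      · exact hadj

/-! Automorphisms. -/

/-- The group of automorphisms of the metric tree: bijections of the vertices that preserve the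
distance. -/
def Aut : Subgroup (Equiv.Perm V) where
  carrier := {g | ∀ a b, J.rho (g a) (g b) = J.rho a b}
  one_mem' := fun _ _ => rfl
  mul_mem' := fun {g h} hg hh a b => by
    simp only [mem_ofPred_eq, Equiv.Perm.coe_mul, Function.comp_apply] at *
    rw [hg, hh]
  inv_mem' := fun {g} hg a b => by
    have := hg (g⁻¹ a) (g⁻¹ b)
    simpa using this.symm

lemma Aut.adj_iff (g : J.Aut) (a b : V) :
    J.graph.Adj ((g : Equiv.Perm V) a) ((g : Equiv.Perm V) b) ↔ J.graph.Adj a b := by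
  have hg : ∀ a b, J.rho ((g : Equiv.Perm V) a) ((g : Equiv.Perm V) b) = J.rho a b := g.2
  rw [J.adj_iff, J.adj_iff, hg, (g : Equiv.Perm V).injective.ne_iff]
  refine and_congr_right fun _ => ?_
  rw [(g : Equiv.Perm V).surjective.forall]
  simp only [hg, (g : Equiv.Perm V).injective.eq_iff]

/-! Subtrees. -/

/-- A set of vertices spans a (possibly empty) subtree if the induced subgraph is connected. -/
def IsSubtree (S : Set V) : Prop := (J.graph.induce S).Preconnected

/-- A right subtree: only finitely many edges lead out of it. -/
def IsRight (S : Set V) : Prop :=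
  J.IsSubtree S ∧ {p : V × V | p.1 ∈ S ∧ p.2 ∉ S ∧ J.graph.Adj p.1 p.2}.Finite

/-- A branch with root `a`: a subtree with exactly one edge leading out of it, starting at `a`. -/
def IsBranch (S : Set V) (a : V) : Prop :=
  J.IsSubtree S ∧ ∃ b, {p : V × V | p.1 ∈ S ∧ p.2 ∉ S ∧ J.graph.Adj p.1 p.2} = {(a, b)}

variable {J} in
lemma isSubtree_iff {S : Set V} :
    J.IsSubtree S ↔ ∀ a ∈ S, ∀ b ∈ S, ∀ c ∈ (J.way a b).support, c ∈ S := by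
  classical
  constructor
  · intro h a ha b hb c hc
    obtain ⟨p⟩ := h ⟨a, ha⟩ ⟨b, hb⟩
    have := J.way_unique (p.map (SimpleGraph.Embedding.induce S).toHom).bypass_isPath
    have hc' : c ∈ (p.map (SimpleGraph.Embedding.induce S).toHom).bypass.support := by
      have h2 := congrArg SimpleGraph.Walk.support this
      exact h2 ▸ hc
    have h3 := SimpleGraph.Walk.support_bypass_subset_support _ hc'
    rw [SimpleGraph.Walk.support_map] at h3
    obtain ⟨x, -, rfl⟩ := List.mem_map.1 h3
    exact x.2
  · intro h a b
    exact ⟨(J.way a b).induce S (h a a.2 b b.2)⟩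

lemma IsRight.inter {S T : Set V} (hS : J.IsRight S) (hT : J.IsRight T) : J.IsRight (S ∩ T) := by
  refine ⟨isSubtree_iff.2 fun a ha b hb c hc =>
    ⟨isSubtree_iff.1 hS.1 a ha.1 b hb.1 c hc, isSubtree_iff.1 hT.1 a ha.2 b hb.2 c hc⟩,
    (hS.2.union hT.2).subset ?_⟩
  rintro ⟨a, b⟩ ⟨h1, h2, h3⟩
  by_cases hb : b ∈ S
  · exact Or.inr ⟨h1.2, fun hb' => h2 ⟨hb, hb'⟩, h3⟩
  · exact Or.inl ⟨h1.1, hb, h3⟩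

lemma IsRight.preimage {S : Set V} (hS : J.IsRight S) (g : J.Aut) :
    J.IsRight ((g : Equiv.Perm V) ⁻¹' S) := by
  refine ⟨?_, ?_⟩
  · intro a b
    obtain ⟨p⟩ := hS.1 ⟨_, a.2⟩ ⟨_, b.2⟩
    have hmem : ∀ x : S, (g : Equiv.Perm V)⁻¹ (x : V) ∈ (g : Equiv.Perm V) ⁻¹' S := by
      intro x; simp
    let f : J.graph.induce S →g J.graph.induce ((g : Equiv.Perm V) ⁻¹' S) :=
      { toFun := fun x => ⟨(g : Equiv.Perm V)⁻¹ (x : V), hmem x⟩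
        map_rel' := fun {x y} hxy => by
          have := (Aut.adj_iff J g⁻¹ (x : V) (y : V)).2 hxy
          simpa using this }
    have hf := fun (x : V) (hx : (g : Equiv.Perm V) x ∈ S) =>
      (show f ⟨_, hx⟩ = ⟨x, hx⟩ from Subtype.ext (by simp [f]))
    have q := p.map f
    rw [hf _ a.2, hf _ b.2] at q
    exact ⟨q⟩
  · refine (hS.2.preimage (f := Prod.map (g : Equiv.Perm V) (g : Equiv.Perm V)) ?_).subset ?_
    · exact ((g : Equiv.Perm V).injective.prodMap (g : Equiv.Perm V).injective).injOn
    · rintro ⟨a, b⟩ ⟨h1, h2, h3⟩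
      exact ⟨h1, h2, (Aut.adj_iff J g a b).2 h3⟩

/-! Hierarchomorphisms. -/

variable {Γ : Type*} [Group Γ] (act : Γ →* J.Aut)

/-- The large group of hierarchomorphisms: bijections of the vertices that coincide on each piece
of some finite partition into right subtrees with the action of an element of `Γ`. -/
def HierO : Subgroup (Equiv.Perm V) where
  carrier := {g | ∃ (ι : Type) (_ : Finite ι) (S : ι → Set V) (γ : ι → Γ),
    (∀ j, J.IsRight (S j)) ∧ Pairwise (Function.onFun Disjoint S) ∧ (⋃ j, S j) = univ ∧
    ∀ j, ∀ a ∈ S j, g a = (act (γ j) : Equiv.Perm V) a}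
  one_mem' := by
    refine ⟨Unit, inferInstance, fun _ => univ, fun _ => 1, fun _ => ⟨?_, ?_⟩, ?_, ?_, ?_⟩
    · exact isSubtree_iff.2 fun _ _ _ _ _ _ => mem_univ _
    · simp
    · intro i j hij; exact absurd (Subsingleton.elim i j) hij
    · exact iUnion_const _
    · intro j a _; simp
  mul_mem' := by
    rintro g h ⟨ι, hι, S, γ, h1, h2, h3, h4⟩ ⟨κ, hκ, T, δ, k1, k2, k3, k4⟩
    refine ⟨ι × κ, inferInstance, fun p => (act (δ p.2) : Equiv.Perm V) ⁻¹' (S p.1) ∩ T p.2,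
      fun p => γ p.1 * δ p.2, ?_, ?_, ?_, ?_⟩
    · rintro ⟨i, j⟩
      exact IsRight.inter J (IsRight.preimage J (h1 i) _) (k1 j)
    · rintro ⟨i, j⟩ ⟨i', j'⟩ hne
      by_cases hj : j = j'
      · subst hj
        have hi : i ≠ i' := fun hi => hne (by rw [hi])
        exact Disjoint.mono inter_subset_left inter_subset_left
          (Disjoint.preimage _ (h2 hi))
      · exact Disjoint.mono inter_subset_right inter_subset_right (k2 hj)
    · refine eq_univ_of_forall fun a => ?_
      obtain ⟨j, hj⟩ := mem_iUnion.1 (k3 ▸ mem_univ a : a ∈ ⋃ j, T j)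
      obtain ⟨i, hi⟩ := mem_iUnion.1
        (h3 ▸ mem_univ ((act (δ j) : Equiv.Perm V) a) : _ ∈ ⋃ j, S j)
      exact mem_iUnion.2 ⟨(i, j), hi, hj⟩
    · rintro ⟨i, j⟩ a ⟨hi, hj⟩
      simp only [Equiv.Perm.coe_mul, Function.comp_apply, map_mul, Subgroup.coe_mul]
      rw [k4 j a hj, h4 i _ hi]
  inv_mem' := by
    rintro g ⟨ι, hι, S, γ, h1, h2, h3, h4⟩
    have key : ∀ j b, b ∈ (act (γ j)⁻¹ : Equiv.Perm V) ⁻¹' (S j) ↔ g⁻¹ b ∈ S j := by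
      intro j b
      constructor
      · intro hb
        have := h4 j _ hb
        have e : g⁻¹ b = (act (γ j)⁻¹ : Equiv.Perm V) b := by
          rw [Equiv.Perm.inv_eq_iff_eq, this]; simp
        rw [e]; exact hb
      · intro hb
        have := h4 j _ hb
        have e : g⁻¹ b = (act (γ j)⁻¹ : Equiv.Perm V) b := by
          have h5 : b = (act (γ j) : Equiv.Perm V) (g⁻¹ b) := by simpa using this
          conv_rhs => rw [h5]
          simp
        rw [mem_preimage, ← e]; exact hb
    refine ⟨ι, hι, fun j => (act (γ j)⁻¹ : Equiv.Perm V) ⁻¹' (S j), fun j => (γ j)⁻¹, ?_, ?_, ?_, ?_⟩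
    · intro j
      have := IsRight.preimage J (h1 j) (act (γ j)⁻¹)
      exact this
    · intro i j hij
      refine Set.disjoint_left.2 fun b hb hb' => ?_
      exact Set.disjoint_left.1 (h2 hij) ((key i b).1 hb) ((key j b).1 hb')
    · refine eq_univ_of_forall fun b => ?_
      obtain ⟨j, hj⟩ := mem_iUnion.1 (h3 ▸ mem_univ (g⁻¹ b) : _ ∈ ⋃ j, S j)
      exact mem_iUnion.2 ⟨j, (key j b).2 hj⟩
    · intro j b hb
      have := h4 j _ hb
      rw [Equiv.Perm.inv_eq_iff_eq, this]; simp

/-! The absolute. -/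

/-- A ray: an infinite way `a 0, a 1, a 2, ...`. -/
structure Ray where
  toFun : ℕ → V
  inj : Function.Injective toFun
  adj : ∀ n, J.graph.Adj (toFun n) (toFun (n + 1))

instance : CoeFun J.Ray (fun _ => ℕ → V) := ⟨Ray.toFun⟩

/-- Two rays are equivalent if they coincide, up to a shift, from some place on. -/
instance raySetoid : Setoid J.Ray where
  r r s := ∃ m n, ∀ i, r (i + m) = s (i + n)
  iseqv :=
    { refl := fun _ => ⟨0, 0, fun _ => rfl⟩
      symm := fun ⟨m, n, h⟩ => ⟨n, m, fun i => (h i).symm⟩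
      trans := by
        rintro r s t ⟨m, n, h⟩ ⟨p, q, k⟩
        refine ⟨p + m, n + q, fun i => ?_⟩
        rw [← add_assoc, h, ← add_assoc, ← k]
        congr 1; omega }

/-- The absolute of the tree. -/
def Abs : Type _ := Quotient J.raySetoid

variable {J} in
/-- The point of the absolute to which a ray leads. -/
def Ray.toAbs (r : J.Ray) : J.Abs := Quotient.mk _ r

variable {J} in
/-- The tail of a ray. -/
def Ray.tail (r : J.Ray) (N : ℕ) : J.Ray where
  toFun i := r (i + N)
  inj i j h := by have := r.inj h; omega
  adj n := by have := r.adj (n + N); rwa [add_right_comm] at this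

lemma Ray.toAbs_tail (r : J.Ray) (N : ℕ) : (r.tail N).toAbs = r.toAbs :=
  Quotient.sound ⟨0, N, fun _ => rfl⟩

/-- The absolute of a subtree, as a subset of the absolute of the tree. -/
def absOf (S : Set V) : Set J.Abs := {ω | ∃ r : J.Ray, r.toAbs = ω ∧ ∀ n, r n ∈ S}

/-- The topology of the absolute, generated by the balls, i.e. the absolutes of the branches. (The
complement of a branch is a branch, so that the balls are open and closed.) -/
instance : TopologicalSpace J.Abs :=
  TopologicalSpace.generateFrom {B | ∃ S a, J.IsBranch S a ∧ B = J.absOf S}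

instance : MeasurableSpace J.Abs := borel _

instance : BorelSpace J.Abs := ⟨rfl⟩

/-! The action of hierarchomorphisms on the absolute. -/

/-- A hierarchomorphism coincides with an element of `Γ` on a tail of each ray. -/
lemma HierO.eventually {g : Equiv.Perm V} (hg : g ∈ J.HierO act) (r : J.Ray) :
    ∃ (N : ℕ) (γ : Γ), ∀ n, N ≤ n → g (r n) = (act γ : Equiv.Perm V) (r n) := by
  obtain ⟨ι, hι, S, γ, h1, h2, h3, h4⟩ := hg
  have hfin : (⋃ j, {n | r n ∈ S j ∧ r (n + 1) ∉ S j}).Finite := by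
    refine finite_iUnion fun j => ?_
    refine ((h1 j).2.preimage (f := fun n => (r n, r (n + 1))) ?_).subset ?_
    · intro m _ n _ h
      exact r.inj (congrArg Prod.fst h)
    · intro n hn
      exact ⟨hn.1, hn.2, r.adj n⟩
  obtain ⟨B, hB⟩ := hfin.bddAbove
  obtain ⟨j, hj⟩ := mem_iUnion.1 (h3 ▸ mem_univ (r (B + 1)) : _ ∈ ⋃ j, S j)
  refine ⟨B + 1, γ j, fun n hn => h4 j _ ?_⟩
  induction n, hn using Nat.le_induction with
  | base => exact hj
  | succ n hn ih =>
    by_contra hc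
    have := hB (mem_iUnion.2 ⟨j, ih, hc⟩)
    omega

lemma HierO.exists_ray {g : Equiv.Perm V} (hg : g ∈ J.HierO act) (r : J.Ray) :
    ∃ (N : ℕ) (r' : J.Ray), ∀ i, r' i = g (r (i + N)) := by
  obtain ⟨N, γ, h⟩ := HierO.eventually J act hg r
  refine ⟨N, ⟨fun i => g (r (i + N)), fun i j hij => ?_, fun n => ?_⟩, fun _ => rfl⟩
  · have := r.inj (g.injective hij); omega
  · rw [h _ (by omega), h _ (by omega), Aut.adj_iff]
    have := r.adj (n + N)
    rwa [add_right_comm] at this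

/-- `g` sends the point `ω` to `ν`: it sends some ray leading to `ω` to a ray leading to `ν`. -/
def SendsAbs (g : Equiv.Perm V) (ω ν : J.Abs) : Prop :=
  ∃ r r' : J.Ray, r.toAbs = ω ∧ r'.toAbs = ν ∧ ∀ i, r' i = g (r i)

lemma SendsAbs.unique {g : Equiv.Perm V} {ω ν ν' : J.Abs} (h : J.SendsAbs g ω ν)
    (h' : J.SendsAbs g ω ν') : ν = ν' := by
  obtain ⟨r, s, rfl, rfl, hs⟩ := h
  obtain ⟨r', s', h1, rfl, hs'⟩ := h'
  obtain ⟨m, n, h⟩ := Quotient.exact h1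
  refine Quotient.sound ⟨n, m, fun i => ?_⟩
  rw [hs, hs', h]

lemma HierO.exists_sends {g : Equiv.Perm V} (hg : g ∈ J.HierO act) (ω : J.Abs) :
    ∃ ν, J.SendsAbs g ω ν := by
  obtain ⟨r, rfl⟩ : ∃ r : J.Ray, r.toAbs = ω := Quotient.exists_rep ω
  obtain ⟨N, r', h⟩ := HierO.exists_ray J act hg r
  exact ⟨r'.toAbs, r.tail N, r', Ray.toAbs_tail J r N, rfl, h⟩

/-- The map of the absolute induced by a hierarchomorphism. -/
def absMap (g : J.HierO act) (ω : J.Abs) : J.Abs :=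
  (HierO.exists_sends J act g.2 ω).choose

lemma absMap_spec (g : J.HierO act) (ω : J.Abs) :
    J.SendsAbs (g : Equiv.Perm V) ω (J.absMap act g ω) :=
  (HierO.exists_sends J act g.2 ω).choose_spec

lemma SendsAbs.comp {g h : J.HierO act} {ω ν κ : J.Abs}
    (hh : J.SendsAbs (h : Equiv.Perm V) ω ν) (hg : J.SendsAbs (g : Equiv.Perm V) ν κ) :
    J.SendsAbs ((g * h : J.HierO act) : Equiv.Perm V) ω κ := by
  obtain ⟨r, s, rfl, rfl, hs⟩ := hh
  obtain ⟨r', s', h1, rfl, hs'⟩ := hg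
  obtain ⟨m, n, e⟩ := Quotient.exact h1
  refine ⟨r.tail n, s'.tail m, Ray.toAbs_tail J _ _, Ray.toAbs_tail J _ _, fun i => ?_⟩
  change s' (i + m) = (g : Equiv.Perm V) ((h : Equiv.Perm V) (r (i + n)))
  rw [hs', e, hs]

/-- The homomorphism that sends a hierarchomorphism to its induced transformation of the
absolute. Its range is the small group of hierarchomorphisms. -/
def toHier : J.HierO act →* Equiv.Perm J.Abs :=
  MonoidHom.toHomPerm
    { toFun := fun g => (J.absMap act g : Function.End J.Abs)
      map_one' := by
        funext ω
        obtain ⟨r, hr⟩ : ∃ r : J.Ray, r.toAbs = ω := Quotient.exists_rep ω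
        exact SendsAbs.unique J (J.absMap_spec act 1 ω) ⟨r, r, hr, hr, fun _ => rfl⟩
      map_mul' := fun g h => by
        funext ω
        exact SendsAbs.unique J (J.absMap_spec act (g * h) ω)
          (SendsAbs.comp J act (J.absMap_spec act h ω) (J.absMap_spec act g _)) }

/-! The pseudoderivative. -/

lemma way_of_closer {ξ b c : V} (h : J.graph.Adj b c)
    (hlt : J.rho ξ c < J.rho ξ b) : J.way b ξ = (J.way c ξ).cons h := by
  have hb : b ∉ (J.way c ξ).support := by
    intro hb
    have h1 := J.rho_split hb
    have h2 := J.rho_pos h.ne'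
    rw [J.rho_comm c ξ, J.rho_comm b ξ] at h1
    linarith
  exact (J.way_unique ((J.way_isPath c ξ).cons (h := h) hb)).symm

lemma closer_unique {ξ b c c' : V} (h : J.graph.Adj b c) (h' : J.graph.Adj b c')
    (hlt : J.rho ξ c < J.rho ξ b) (hlt' : J.rho ξ c' < J.rho ξ b) : c = c' := by
  have e := (J.way_of_closer h hlt).symm.trans (J.way_of_closer h' hlt')
  have := congrArg SimpleGraph.Walk.snd e
  simpa using this

lemma Ray.eventually_away (r : J.Ray) (ξ : V) : ∃ N, ∀ M, N ≤ M →
    J.rho ξ (r (M + 1)) = J.rho ξ (r M) + J.len s(r M, r (M + 1)) := by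
  have hpos : ∀ M, 0 < J.len s(r M, r (M + 1)) := fun M =>
    J.len_pos _ ((SimpleGraph.mem_edgeSet _).2 (r.adj M))
  obtain ⟨N, hN⟩ : ∃ N, J.rho ξ (r (N + 1)) = J.rho ξ (r N) + J.len s(r N, r (N + 1)) := by
    by_contra hcon
    push Not at hcon
    have key : ∀ M, (J.way (r M) ξ).length + M = (J.way (r 0) ξ).length := by
      intro M
      induction M with
      | zero => rfl
      | succ M ih =>
        have h1 := (J.rho_step ξ (r.adj M)).resolve_left (hcon M)
        have h2 := J.way_of_closer (ξ := ξ) (r.adj M) (by have := hpos M; linarith)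
        have h3 := congrArg SimpleGraph.Walk.length h2
        rw [SimpleGraph.Walk.length_cons] at h3
        omega
    have := key ((J.way (r 0) ξ).length + 1)
    omega
  refine ⟨N, fun M hM => ?_⟩
  induction M, hM using Nat.le_induction with
  | base => exact hN
  | succ M hM ih =>
    refine (J.rho_step ξ (r.adj (M + 1))).resolve_right fun hc => ?_
    have e := J.closer_unique (ξ := ξ) (r.adj (M + 1)) (r.adj M).symm
      (by have := hpos (M + 1); linarith) (by have := hpos M; linarith)
    have := r.inj e
    omega

lemma Ray.eventually_diff (r : J.Ray) (ξ η : V) :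
    ∃ c : ℝ, ∀ᶠ M in atTop, J.rho ξ (r M) - J.rho η (r M) = c := by
  obtain ⟨N, hN⟩ := r.eventually_away J ξ
  obtain ⟨N', hN'⟩ := r.eventually_away J η
  refine ⟨J.rho ξ (r (max N N')) - J.rho η (r (max N N')), ?_⟩
  filter_upwards [eventually_ge_atTop (max N N')] with M hM
  induction M, hM using Nat.le_induction with
  | base => rfl
  | succ M hM ih =>
    have := hN M (le_trans (le_max_left _ _) hM)
    have := hN' M (le_trans (le_max_right _ _) hM)
    linarith

/-- For a hierarchomorphism `g` and a point `ω` of the absolute, the sequence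
`rho ξ (a M) - rho ξ (g (a M))` becomes constant, with the same constant for all rays `a` that lead
to `ω`. -/
lemma exists_pseudoderiv (ξ : V) (g : J.HierO act) (ω : J.Abs) :
    ∃ c : ℝ, ∀ r : J.Ray, r.toAbs = ω →
      ∀ᶠ M in atTop, J.rho ξ (r M) - J.rho ξ ((g : Equiv.Perm V) (r M)) = c := by
  obtain ⟨r, rfl⟩ : ∃ r : J.Ray, r.toAbs = ω := Quotient.exists_rep ω
  obtain ⟨N, γ, h⟩ := HierO.eventually J act g.2 r
  obtain ⟨c, hc⟩ := r.eventually_diff J ξ ((act γ : Equiv.Perm V)⁻¹ ξ)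
  have hr : ∀ᶠ M in atTop, J.rho ξ (r M) - J.rho ξ ((g : Equiv.Perm V) (r M)) = c := by
    filter_upwards [hc, eventually_ge_atTop N] with M hM hNM
    rw [← hM, h M hNM]
    have := (act γ).2 ((act γ : Equiv.Perm V)⁻¹ ξ) (r M)
    rw [Equiv.Perm.inv_def, Equiv.apply_symm_apply] at this
    rw [Equiv.Perm.inv_def, this]
  refine ⟨c, fun s hs => ?_⟩
  obtain ⟨m, n, e⟩ := Quotient.exact hs
  obtain ⟨K, hK⟩ := eventually_atTop.1 hr
  filter_upwards [eventually_ge_atTop (K + m)] with M hM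
  have := hK (M - m + n) (by omega)
  rw [← e] at this
  rwa [Nat.sub_add_cancel (by omega)] at this

/-- The pseudoderivative `n(g, ω)`: the eventual value of `rho ξ (a M) - rho ξ (g (a M))` along the
rays `a` leading to `ω`. -/
def pseudoderiv (ξ : V) (g : J.HierO act) (ω : J.Abs) : ℝ :=
  (J.exists_pseudoderiv act ξ g ω).choose

/-! The Hilbert space. -/

/-- The closest neighbour in the direction of `o`. -/
lemma exists_parent {o a : V} (h : a ≠ o) :
    ∃ (p : V) (hp : J.graph.Adj a p), J.way a o = (J.way p o).cons hp := by
  have hw := J.way_isPath a o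
  generalize hq : J.way a o = q at hw
  cases q with
  | nil => exact absurd rfl h
  | @cons _ p _ hadj q =>
    refine ⟨p, hadj, ?_⟩
    rw [← J.way_unique hw.of_cons]

open scoped Classical in
/-- Coordinates in which `lam ^ rho a b` becomes a scalar product. -/
def coord (lam : ℝ) (o : V) (a : V) : V →₀ ℝ :=
  if h : a = o then Finsupp.single o 1
  else
    (lam ^ J.len s(a, (J.exists_parent h).choose)) • coord lam o (J.exists_parent h).choose +
      Finsupp.single a √(1 - (lam ^ J.len s(a, (J.exists_parent h).choose)) ^ 2)
termination_by (J.way a o).length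
decreasing_by
  obtain ⟨hp, e⟩ := (J.exists_parent h).choose_spec
  have := congrArg SimpleGraph.Walk.length e
  rw [SimpleGraph.Walk.length_cons] at this
  omega

lemma coord_self (lam : ℝ) (o : V) : J.coord lam o o = Finsupp.single o 1 := by
  rw [coord]; simp

lemma exists_coord_step (lam : ℝ) {o a : V} (h : a ≠ o) :
    ∃ (p : V) (hp : J.graph.Adj a p), J.way a o = (J.way p o).cons hp ∧
      J.coord lam o a = (lam ^ J.len s(a, p)) • J.coord lam o p +
        Finsupp.single a √(1 - (lam ^ J.len s(a, p)) ^ 2) := by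
  obtain ⟨hp, e⟩ := (J.exists_parent h).choose_spec
  refine ⟨_, hp, e, ?_⟩
  rw [coord, dif_neg h]

lemma coord_support (lam : ℝ) (o : V) : ∀ (n : ℕ) (a : V), (J.way a o).length = n →
    ∀ v, J.coord lam o a v ≠ 0 → v = a ∨ (J.way v o).length < n := by
  intro n
  induction n with
  | zero =>
    intro a ha v hv
    obtain rfl : a = o := SimpleGraph.Walk.eq_of_length_eq_zero ha
    rw [coord_self] at hv
    left
    by_contra hne
    exact hv (Finsupp.single_eq_of_ne hne)
  | succ n ih =>
    intro a ha v hv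
    have hne : a ≠ o := by
      rintro rfl
      rw [← J.way_unique SimpleGraph.Walk.IsPath.nil] at ha
      simp at ha
    obtain ⟨p, hp, e, hc⟩ := J.exists_coord_step lam hne
    by_cases hva : v = a
    · exact Or.inl hva
    right
    rw [hc, Finsupp.add_apply, Finsupp.single_eq_of_ne hva, add_zero] at hv
    have hlen : (J.way p o).length = n := by
      have := congrArg SimpleGraph.Walk.length e
      rw [SimpleGraph.Walk.length_cons] at this
      omega
    rcases ih p hlen v (fun h0 => hv (by simp [h0])) with rfl | h
    · omega
    · omega

/-- The scalar product of finitely supported vectors. -/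
def dot (x y : V →₀ ℝ) : ℝ := x.sum fun v s => s * y v

lemma dot_comm (x y : V →₀ ℝ) : dot x y = dot y x := by
  classical
  unfold dot
  rw [Finsupp.sum_of_support_subset x (Finset.subset_union_left (s₂ := y.support)) _ (by simp),
    Finsupp.sum_of_support_subset y (Finset.subset_union_right (s₁ := x.support)) _ (by simp)]
  exact Finset.sum_congr rfl fun _ _ => mul_comm _ _

lemma dot_step (c s : ℝ) (a : V) (x y : V →₀ ℝ) :
    dot (c • x + Finsupp.single a s) y = c * dot x y + s * y a := by
  unfold dot
  rw [Finsupp.sum_add_index' (by simp) (by intros; ring), Finsupp.sum_smul_index (by simp),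
    Finsupp.sum_single_index (by simp), Finsupp.mul_sum]
  simp only [mul_assoc]

lemma dot_coord {lam : ℝ} (h0 : 0 < lam) (h1 : lam < 1) (o : V) : ∀ (n : ℕ) (a b : V),
    (J.way a o).length + (J.way b o).length = n →
    dot (J.coord lam o a) (J.coord lam o b) = lam ^ J.rho a b := by
  classical
  intro n
  induction n using Nat.strong_induction_on with
  | _ n ih =>
    have main : ∀ a b : V, (J.way a o).length + (J.way b o).length = n →
        (J.way b o).length ≤ (J.way a o).length →
        dot (J.coord lam o a) (J.coord lam o b) = lam ^ J.rho a b := by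
      intro a b hab hle
      by_cases hao : a = o
      · subst hao
        have hz : (J.way a a).length = 0 := by
          rw [← J.way_unique SimpleGraph.Walk.IsPath.nil]; rfl
        have hb : b = a := SimpleGraph.Walk.eq_of_length_eq_zero (p := J.way b a) (by omega)
        subst hb
        rw [coord_self, rho_self]
        simp [dot]
      · obtain ⟨p, hp, e, hc⟩ := J.exists_coord_step lam hao
        have hlen := congrArg SimpleGraph.Walk.length e
        rw [SimpleGraph.Walk.length_cons] at hlen
        have hpa : J.coord lam o p a = 0 := by
          by_contra hne
          rcases J.coord_support lam o _ p rfl a hne with h | h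
          · exact hp.ne h
          · omega
        have hl : 0 < J.len s(a, p) := J.len_pos _ ((SimpleGraph.mem_edgeSet _).2 hp)
        have ht : lam ^ J.len s(a, p) < 1 := Real.rpow_lt_one h0.le h1 hl
        have ht0 : 0 < lam ^ J.len s(a, p) := Real.rpow_pos_of_pos h0 _
        by_cases heq : a = b
        · subst heq
          have hsq := Real.mul_self_sqrt (show 0 ≤ 1 - (lam ^ J.len s(a, p)) ^ 2 by nlinarith)
          have hpp := ih _ (by omega) p p rfl
          rw [rho_self, Real.rpow_zero] at hpp ⊢
          have haa : J.coord lam o a a = √(1 - (lam ^ J.len s(a, p)) ^ 2) := by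
            rw [hc]; simp [hpa]
          conv_lhs => rw [hc, dot_step, ← hc]
          rw [haa, hsq, dot_comm, hc, dot_step, hpp, hpa]
          ring
        · have hba : J.coord lam o b a = 0 := by
            by_contra hne
            rcases J.coord_support lam o _ b rfl a hne with h | h
            · exact heq h
            · omega
          rw [hc, dot_step, hba, mul_zero, add_zero, ih _ (by omega) p b rfl,
            ← Real.rpow_add h0]
          congr 1
          -- the way from `p` to `b` avoids `a`
          have hav : a ∉ (J.way p b).support := by
            have hw := J.way_unique ((J.way p o).append (J.way b o).reverse).bypass_isPath
            intro hmem
            rw [← hw] at hmem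
            have hm := SimpleGraph.Walk.support_bypass_subset_support _ hmem
            rw [SimpleGraph.Walk.mem_support_append_iff, SimpleGraph.Walk.support_reverse,
              List.mem_reverse] at hm
            rcases hm with hm | hm
            · have h2 := J.way_unique ((J.way_isPath p o).dropUntil hm)
              have h3 := congrArg SimpleGraph.Walk.length ((J.way p o).take_spec hm)
              rw [h2, SimpleGraph.Walk.length_append] at h3
              omega
            · have h2 := J.way_unique ((J.way_isPath b o).dropUntil hm)
              have h3 := congrArg SimpleGraph.Walk.length ((J.way b o).take_spec hm)
              rw [h2, SimpleGraph.Walk.length_append] at h3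
              have h4 : ((J.way b o).takeUntil a hm).length = 0 := by omega
              exact heq (SimpleGraph.Walk.eq_of_length_eq_zero h4).symm
          rw [J.rho_cons hp (J.way_isPath p b) hav]
    intro a b hab
    rcases le_total (J.way b o).length (J.way a o).length with hle | hle
    · exact main a b hab hle
    · rw [dot_comm, J.rho_comm]
      exact main b a (by omega) hle

/-- Formal finite linear combinations of the vertices. -/
def PreH (_J : MetricTree V) (_lam : Ioo (0 : ℝ) 1) : Type _ := V →₀ ℝ

instance (lam : Ioo (0 : ℝ) 1) : AddCommGroup (J.PreH lam) :=
  inferInstanceAs (AddCommGroup (V →₀ ℝ))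

instance (lam : Ioo (0 : ℝ) 1) : Module ℝ (J.PreH lam) :=
  inferInstanceAs (Module ℝ (V →₀ ℝ))

/-- The bilinear form with value `lam ^ rho a b` on the pair of vertices `a`, `b`. -/
def form (lam : ℝ) (x y : V →₀ ℝ) : ℝ :=
  x.sum fun a s => y.sum fun b t => s * t * lam ^ J.rho a b

lemma form_nonneg (lam : Ioo (0 : ℝ) 1) (x : V →₀ ℝ) : 0 ≤ J.form lam x x := by
  classical
  obtain ⟨o⟩ := J.isTree.connected.nonempty
  let T := x.support.biUnion fun a => (J.coord lam o a).support
  have hT : ∀ a ∈ x.support, ∀ b, (lam : ℝ) ^ J.rho a b =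
      ∑ v ∈ T, J.coord lam o a v * J.coord lam o b v := by
    intro a ha b
    rw [← J.dot_coord lam.2.1 lam.2.2 o _ a b rfl, dot]
    exact Finsupp.sum_of_support_subset _
      (Finset.subset_biUnion_of_mem (fun a => (J.coord lam o a).support) ha) _ (by simp)
  have : J.form lam x x = ∑ v ∈ T, (∑ a ∈ x.support, x a * J.coord lam o a v) ^ 2 := by
    unfold form Finsupp.sum
    calc _ = ∑ a ∈ x.support, ∑ b ∈ x.support, ∑ v ∈ T,
          (x a * J.coord lam o a v) * (x b * J.coord lam o b v) := by
          refine Finset.sum_congr rfl fun a ha => Finset.sum_congr rfl fun b _ => ?_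
          change x a * x b * (lam : ℝ) ^ J.rho a b = _
          rw [hT a ha b, Finset.mul_sum]
          exact Finset.sum_congr rfl fun _ _ => by ring
      _ = _ := by
          simp_rw [sq, Finset.sum_mul_sum]
          rw [Finset.sum_comm (s := T)]
          refine Finset.sum_congr rfl fun a _ => ?_
          rw [Finset.sum_comm (s := T)]
  rw [this]
  exact Finset.sum_nonneg fun _ _ => sq_nonneg _

lemma form_comm (lam : ℝ) (x y : V →₀ ℝ) : J.form lam y x = J.form lam x y := by
  unfold form
  rw [Finsupp.sum_comm]
  refine Finsupp.sum_congr fun a _ => Finsupp.sum_congr fun b _ => ?_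
  rw [J.rho_comm, mul_comm (y b)]

lemma form_add (lam : ℝ) (x y z : V →₀ ℝ) :
    J.form lam (x + y) z = J.form lam x z + J.form lam y z := by
  unfold form
  rw [Finsupp.sum_add_index'] <;> simp [← Finsupp.sum_add, add_mul]

lemma form_smul (lam : ℝ) (x y : V →₀ ℝ) (r : ℝ) :
    J.form lam (r • x) y = r * J.form lam x y := by
  unfold form
  rw [Finsupp.sum_smul_index] <;> simp [Finsupp.mul_sum, ← mul_assoc]

instance core (lam : Ioo (0 : ℝ) 1) : PreInnerProductSpace.Core ℝ (J.PreH lam) where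
  inner x y := J.form lam x y
  conj_inner_symm x y := J.form_comm lam x y
  re_inner_nonneg x := J.form_nonneg lam x
  add_left x y z := J.form_add lam x y z
  smul_left x y r := J.form_smul lam x y r

instance (lam : Ioo (0 : ℝ) 1) : SeminormedAddCommGroup (J.PreH lam) :=
  InnerProductSpace.Core.toSeminormedAddCommGroup (𝕜 := ℝ)

instance (lam : Ioo (0 : ℝ) 1) : InnerProductSpace ℝ (J.PreH lam) := .ofCore _

/-- The real Hilbert space spanned by vectors `e a` with `⟪e a, e b⟫ = lam ^ rho a b`. -/
abbrev H (lam : Ioo (0 : ℝ) 1) : Type _ := UniformSpace.Completion (J.PreH lam)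

/-- The formal vector of the vertex `a`. -/
def pre (lam : Ioo (0 : ℝ) 1) (a : V) : J.PreH lam := (Finsupp.single a 1 : V →₀ ℝ)

/-- The vector `e a` of the Hilbert space. -/
def e (lam : Ioo (0 : ℝ) 1) (a : V) : J.H lam := (J.pre lam a : UniformSpace.Completion _)

lemma inner_e (lam : Ioo (0 : ℝ) 1) (a b : V) :
    inner ℝ (J.e lam a) (J.e lam b) = (lam : ℝ) ^ J.rho a b := by
  rw [e, e, UniformSpace.Completion.inner_coe]
  change J.form lam (Finsupp.single a 1) (Finsupp.single b 1) = _
  simp [form]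

lemma span_e (lam : Ioo (0 : ℝ) 1) : Dense (Submodule.span ℝ (range (J.e lam)) : Set (J.H lam)) := by
  have hspan : ∀ x : J.PreH lam, x ∈ Submodule.span ℝ (range (J.pre lam)) := by
    intro x
    have h : ∀ y : V →₀ ℝ, (show J.PreH lam from y) ∈ Submodule.span ℝ (range (J.pre lam)) := by
      intro y
      induction y using Finsupp.induction_linear with
      | zero => exact Submodule.zero_mem _
      | add y z hy hz => exact Submodule.add_mem _ hy hz
      | single a t =>
        have := Submodule.smul_mem _ t (Submodule.subset_span (mem_range_self (f := J.pre lam) a))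
        convert this using 1
        change Finsupp.single a t = t • Finsupp.single a (1 : ℝ)
        simp
    exact h x
  refine Dense.mono ?_ (UniformSpace.Completion.denseRange_coe (α := J.PreH lam))
  rintro _ ⟨x, rfl⟩
  have := Submodule.mem_map_of_mem
    (f := (UniformSpace.Completion.toComplL (𝕜 := ℝ) (E := J.PreH lam)).toLinearMap) (hspan x)
  rw [Submodule.map_span, ← range_comp] at this
  exact this

/-! Boundary vectors. -/

/-- The boundary of a finite complete subtree: its vertices with exactly one neighbour in it. -/
def bdry (R : Finset V) : Finset V := by
  classical exact R.filter fun a => ∃! b, J.graph.Adj a b ∧ b ∈ R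

/-- A finite complete subtree with `ξ` in its interior: each vertex has either all its neighbours or
exactly one of them in the subtree. -/
def IsComplete (ξ : V) (R : Finset V) : Prop :=
  J.IsSubtree (R : Set V) ∧
    (∀ a ∈ R, (∀ b, J.graph.Adj a b → b ∈ R) ∨ ∃! b, J.graph.Adj a b ∧ b ∈ R) ∧
    ξ ∈ R ∧ ξ ∉ J.bdry R

/-- An increasing sequence of complete subtrees that exhausts the tree. -/
def IsExhaustion (ξ : V) (R : ℕ → Finset V) : Prop :=
  (∀ j, J.IsComplete ξ (R j)) ∧ Monotone R ∧ ∀ a, ∃ j, a ∈ R j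

/-- The branch with root `u` that does not contain `ξ` (it is unique for `u ≠ ξ`; it consists of the
vertices that are separated from `ξ` by `u`, and `u` itself). -/
def outer (ξ u : V) : Set V := ⋃₀ {S | J.IsBranch S u ∧ ξ ∉ S}

/-- The vector `f a = lam ^ (-rho ξ a) • e a`. -/
def f (lam : Ioo (0 : ℝ) 1) (ξ a : V) : J.H lam := (lam : ℝ) ^ (-J.rho ξ a) • J.e lam a

/-- The vector `Ψ[μ|R]` of a real-valued measure `μ` on the absolute. -/
def psi (lam : Ioo (0 : ℝ) 1) (ξ : V) (μ : SignedMeasure J.Abs) (R : Finset V) : J.H lam :=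
  ∑ u ∈ J.bdry R, μ (J.absOf (J.outer ξ u)) • J.f lam ξ u

/-- The measure `μ` belongs to the boundary space: the norms of the vectors `Ψ[μ|R j]` have a finite
limit. -/
def MemE (lam : Ioo (0 : ℝ) 1) (ξ : V) (R : ℕ → Finset V) (μ : SignedMeasure J.Abs) : Prop :=
  ∃ L : ℝ, Tendsto (fun j => ‖J.psi lam ξ μ (R j)‖) atTop (𝓝 L)

/-- `v = Ψ[μ]`, the limit of the vectors `Ψ[μ|R j]`. -/
def IsPsi (lam : Ioo (0 : ℝ) 1) (ξ : V) (R : ℕ → Finset V) (μ : SignedMeasure J.Abs)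
    (v : J.H lam) : Prop :=
  Tendsto (fun j => J.psi lam ξ μ (R j)) atTop (𝓝 v)

/-- The image of the boundary space in the Hilbert space under `Ψ`. -/
def boundaryImage (lam : Ioo (0 : ℝ) 1) (ξ : V) (R : ℕ → Finset V) : Set (J.H lam) :=
  {v | ∃ μ, J.MemE lam ξ R μ ∧ J.IsPsi lam ξ R μ v}

/-- The measure `w(ω) · μ(σ⁻¹ ω)`: the image of `μ` under `σ`, multiplied by the density `w`. -/
def weightedImage (σ : Equiv.Perm J.Abs) (w : J.Abs → ℝ) (μ : SignedMeasure J.Abs) :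
    SignedMeasure J.Abs :=
  VectorMeasure.withDensity (VectorMeasure.map μ σ) w (ContinuousLinearMap.lsmul ℝ ℝ)

/-- The action on measures: `T(g) μ (ω) = lam ^ n(g⁻¹, ω) · μ(g⁻¹ ω)`, where `μ(g⁻¹ ω)` is the measure
`A ↦ μ(g⁻¹ A)`. -/
def T (lam : Ioo (0 : ℝ) 1) (ξ : V) (g : J.HierO act) (μ : SignedMeasure J.Abs) :
    SignedMeasure J.Abs :=
  J.weightedImage (J.toHier act g) (fun ω => (lam : ℝ) ^ J.pseudoderiv act ξ g⁻¹ ω) μ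

end MetricTree

end

/-!
A hierarchomorphism `g` is an isometry on each of finitely many right subtrees, so that the
operator `e a ↦ e (g a)` is bounded as soon as cutting a combination of the vectors `e a` to a right
subtree is. A nonempty right subtree is a finite intersection of half-trees, and for the half-tree at
an edge `uv` the identity `rho a b = rho a u + rho u v + rho v b` bounds the cosine of the angle
between the subspaces of the two half-trees by `lam ^ rho u v < 1` (`abs_inner_toH_le`,
`HierO.exists_norm_le`).

For the boundary, let `u` run through the boundary of a complete subtree `R`. The balls of the
branches `outer ξ u` form a partition of the absolute. If `R` is large, then `g` is an isometry on
each of these branches, and the image of the branch is viewed from a given vertex `b` through the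
image of its root (`IsExhaustion.eventually_rho`). Therefore `horo ξ g b ω`, the eventual value of
`rho b (g a_M) - rho ξ a_M`, is constant on these balls, which makes it a step function, makes the
maps of the absolute continuous, and gives
`⟪U g Ψ[μ|R], e b⟫ = ∫ lam ^ horo ξ g b ω dμ(ω)` (`IsComplete.inner_repU_psi`).
For `g = 1` this holds as soon as `b ∈ R`. So `Ψ[μ|R i]` is the orthogonal projection of
`Ψ[μ|R j]` for `i ≤ j`, and `v = Ψ[μ]` means exactly that
`⟪v, e b⟫ = ∫ lam ^ horo ξ 1 b ω dμ(ω)` for all `b` (`IsPsi.inner_e`, `isPsi_of_inner_e`). The cocycle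
identity for `horo` and the partition into the preimages of the balls show that the integral of
`lam ^ horo ξ 1 b` against `T(g) μ` is that of `lam ^ horo ξ g b` against `μ`
(`chargeIntegral_T`). Hence `U g Ψ[μ] = Ψ[T(g) μ]`, and the invariance of the closure follows by
continuity.

Finally, if `k` acts trivially on the absolute, then its pseudoderivative vanishes: by perfectness
two rays leave a remote vertex `u` through different children, and `2 * rho ξ u` is their Gromov
product `rho ξ x + rho ξ y - rho x y`, which `k` preserves (`horo_eq_zero_of_toHier_eq_one`). By the
cocycle identity the pseudoderivative of `g`, and then `T(g)`, depend only on the map of the absolute.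
-/

/-! ### Integration of step functions against charges -/

namespace MeasureTheory.VectorMeasure

variable {X ι : Type*} {mX : MeasurableSpace X}

lemma isFiniteMeasure_variation (μ : SignedMeasure X) :
    IsFiniteMeasure (VectorMeasure.variation μ) := by
  rw [← SignedMeasure.totalVariation_eq_variation]
  infer_instance

variable {s : Finset ι} {A : ι → Set X}

lemma integrable_of_partition (μ : SignedMeasure X) (hA : ∀ i ∈ s, MeasurableSet (A i))
    (hcover : ∀ x, ∃ i ∈ s, x ∈ A i) {F : X → ℝ} {c : ι → ℝ}
    (hF : ∀ i ∈ s, ∀ x ∈ A i, F x = c i) : VectorMeasure.Integrable μ F := by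
  have := isFiniteMeasure_variation μ
  have hU : (univ : Set X) = ⋃ i ∈ s, A i := by
    ext x; simpa using hcover x
  change MeasureTheory.Integrable F (VectorMeasure.variation μ)
  rw [← MeasureTheory.integrableOn_univ, hU,
    MeasureTheory.integrableOn_finset_iUnion]
  intro i hi
  exact (integrableOn_const (C := c i) (by finiteness)).congr_fun
    (fun x hx => (hF i hi x hx).symm) (hA i hi)

lemma setIntegral_of_eqOn (μ : SignedMeasure X) {S : Set X} {F : X → ℝ} {c : ℝ}
    (hF : ∀ x ∈ S, F x = c) :
    (μ.restrict S).integral F (ContinuousLinearMap.lsmul ℝ ℝ) = c * μ S := by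
  have := isFiniteMeasure_variation μ
  rw [setIntegral_congr_fun (g := fun _ => c) hF, setIntegral_const]
  simp

lemma integral_of_partition (μ : SignedMeasure X) (hA : ∀ i ∈ s, MeasurableSet (A i))
    (hdisj : (s : Set ι).Pairwise (Function.onFun Disjoint A)) (hcover : ∀ x, ∃ i ∈ s, x ∈ A i)
    {F : X → ℝ} {c : ι → ℝ} (hF : ∀ i ∈ s, ∀ x ∈ A i, F x = c i) :
    μ.integral F (ContinuousLinearMap.lsmul ℝ ℝ) = ∑ i ∈ s, c i * μ (A i) := by
  have hint := integrable_of_partition μ hA hcover hF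
  have hU : (univ : Set X) = ⋃ i ∈ s, A i := by
    ext x; simpa using hcover x
  rw [← setIntegral_univ, hU, setIntegral_biUnion_finset s hA hdisj fun i _ => hint.integrableOn]
  exact Finset.sum_congr rfl fun i hi => setIntegral_of_eqOn μ (hF i hi)

end MeasureTheory.VectorMeasure

noncomputable section

namespace MetricTree

variable {V : Type*} (J : MetricTree V)

/-! ### Half-trees -/

variable {J} in
lemma len_pos_of_adj {a b : V} (h : J.graph.Adj a b) : 0 < J.len s(a, b) :=
  J.len_pos _ ((SimpleGraph.mem_edgeSet _).2 h)

lemma rho_nonneg (a b : V) : 0 ≤ J.rho a b := by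
  rcases eq_or_ne a b with rfl | h
  · rw [rho_self]
  · exact (J.rho_pos h).le

lemma rho_triangle (a b c : V) : J.rho a c ≤ J.rho a b + J.rho b c := by
  have hp := J.way_isPath b c
  rw [J.rho_eq hp]
  generalize J.way b c = p
  induction p with
  | nil => simp
  | @cons b d c h q ih =>
    have hstep := J.rho_step a h
    have hl := len_pos_of_adj h
    simp only [SimpleGraph.Walk.edges_cons, List.map_cons, List.sum_cons]
    have := ih (J.way_isPath _ _)
    rcases hstep with h1 | h1 <;> linarith

/-- The half-tree at the end `u` of the edge `uv`: the vertices that are separated from `v`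
by `u`. -/
def half (u v : V) : Set V := {a | J.rho a v = J.rho a u + J.len s(u, v)}

variable {J}

lemma mem_half_self {u v : V} (h : J.graph.Adj u v) : u ∈ J.half u v := by
  simp [half, rho_self, J.rho_adj h]

lemma notMem_half {u v a : V} (h : J.graph.Adj u v) : a ∉ J.half u v ↔ a ∈ J.half v u := by
  have hs := J.rho_step a h
  have hl := len_pos_of_adj h
  simp only [half, mem_ofPred_eq]
  rw [Sym2.eq_swap (a := v)]
  constructor
  · exact fun hn => hs.resolve_left hn
  · intro h1 h2; linarith

lemma mem_half_of_rho_lt {u v a : V} (h : J.graph.Adj u v) (ha : J.rho a u < J.rho a v) :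
    a ∈ J.half u v := by
  by_contra hn
  have h1 : J.rho a u = J.rho a v + J.len s(v, u) := (notMem_half h).1 hn
  have := len_pos_of_adj h.symm
  linarith

lemma rho_lt_of_mem_half {u v a : V} (h : J.graph.Adj u v) (ha : a ∈ J.half u v) :
    J.rho a u < J.rho a v := by
  have h1 : J.rho a v = J.rho a u + J.len s(u, v) := ha
  have := len_pos_of_adj h
  linarith

lemma way_support_subset_half {u v a c : V} (h : J.graph.Adj u v) (ha : a ∈ J.half u v)
    (hc : c ∈ (J.way a u).support) : c ∈ J.half u v := by
  by_contra hn
  have h1 := rho_lt_of_mem_half h.symm ((notMem_half h).1 hn)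
  have h2 := J.rho_split hc
  have h3 := J.rho_triangle a c v
  have h4 := rho_lt_of_mem_half h ha
  linarith

/-- The way between the two half-trees of an edge runs along this edge. -/
lemma rho_across {u v a b : V} (h : J.graph.Adj u v) (ha : a ∈ J.half u v)
    (hb : b ∈ J.half v u) : J.rho a b = J.rho a u + J.len s(u, v) + J.rho v b := by
  have hq : (J.way v b).IsPath := J.way_isPath v b
  have hsupp : ∀ c ∈ (J.way v b).support, c ∈ J.half v u := by
    intro c hc
    refine way_support_subset_half h.symm hb ?_
    rw [← J.way_unique hq.reverse, SimpleGraph.Walk.support_reverse, List.mem_reverse]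
    exact hc
  have hpath : ((J.way a u).append ((J.way v b).cons h)).IsPath := by
    rw [SimpleGraph.Walk.isPath_def, SimpleGraph.Walk.support_append, List.nodup_append]
    refine ⟨(J.way_isPath a u).support_nodup, by simpa using hq.support_nodup, ?_⟩
    rintro c hc d hd rfl
    exact (notMem_half h).2 (hsupp c (by simpa using hd)) (way_support_subset_half h ha hc)
  rw [J.rho_eq hpath, J.rho_eq (J.way_isPath a u), J.rho_eq hq]
  simp [SimpleGraph.Walk.edges_append, add_assoc]

lemma rho_across' {u v a b : V} (h : J.graph.Adj u v) (ha : a ∈ J.half u v)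
    (hb : b ∈ J.half v u) : J.rho a b = J.rho a v + J.rho v b := by
  rw [rho_across h ha hb, show J.rho a v = J.rho a u + J.len s(u, v) from ha]

lemma eq_of_adj_half {u v x y : V} (h : J.graph.Adj u v) (hxy : J.graph.Adj x y)
    (hx : x ∈ J.half u v) (hy : y ∉ J.half u v) : x = u ∧ y = v := by
  have hy' := (notMem_half h).1 hy
  have h1 := rho_across h hx hy'
  have h2 : J.rho y u = J.rho y v + J.len s(v, u) := hy'
  have h3 : J.rho x v = J.rho x u + J.len s(u, v) := hx
  rw [Sym2.eq_swap] at h2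
  have hb := (J.adj_iff.1 hxy).2
  constructor
  · rcases hb u (by rw [h1, J.rho_comm u y, h2, J.rho_comm v y]; ring) with h4 | h4
    · exact h4.symm
    · exact absurd (h4 ▸ mem_half_self h) hy
  · rcases hb v (by rw [h1, h3]) with h4 | h4
    · exact absurd hx ((notMem_half h).2 (h4 ▸ mem_half_self h.symm))
    · exact h4.symm

lemma isSubtree_half {u v : V} (h : J.graph.Adj u v) : J.IsSubtree (J.half u v) := by
  refine isSubtree_iff.2 fun a ha b hb c hc => ?_
  by_contra hn
  have hn' := (notMem_half h).1 hn
  have h1 := rho_across h ha hn'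
  have h2 := rho_across h hb hn'
  have h3 := J.rho_split hc
  have h4 := J.rho_triangle a u b
  have h5 := len_pos_of_adj h
  have h6 := J.rho_nonneg v c
  rw [J.rho_comm c b] at h3
  rw [J.rho_comm u b] at h4
  linarith

lemma isBranch_half {u v : V} (h : J.graph.Adj u v) : J.IsBranch (J.half u v) u := by
  refine ⟨isSubtree_half h, v, ?_⟩
  ext ⟨x, y⟩
  simp only [mem_ofPred_eq, mem_singleton_iff, Prod.mk.injEq]
  constructor
  · rintro ⟨hx, hy, hxy⟩
    exact eq_of_adj_half h hxy hx hy
  · rintro ⟨rfl, rfl⟩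
    exact ⟨mem_half_self h, (notMem_half h).2 (mem_half_self h.symm), h⟩

lemma IsSubtree.subset_half {S : Set V} (hS : J.IsSubtree S) {a b : V} (ha : a ∈ S) (hb : b ∉ S)
    (h : J.graph.Adj a b) : S ⊆ J.half a b := by
  classical
  intro x hx
  by_contra hn
  have hn' := (notMem_half h).1 hn
  refine hb (isSubtree_iff.1 hS x hx a ha b ?_)
  by_contra hbs
  have hpath : ((J.way x b).concat h.symm).IsPath := by
    refine (J.way_isPath x b).concat ?_ h.symm
    intro has
    have h1 := J.rho_split has
    have h2 := rho_lt_of_mem_half h.symm hn'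
    have h3 := J.rho_nonneg a b
    linarith
  rw [← J.way_unique hpath] at hbs
  simp [SimpleGraph.Walk.support_concat] at hbs

/-- A nonempty subtree is the intersection of the half-trees that belong to the edges leading
out of it. -/
lemma IsSubtree.mem_iff {S : Set V} (hS : J.IsSubtree S) {s : V} (hs : s ∈ S) (y : V) :
    y ∈ S ↔ ∀ a ∈ S, ∀ b ∉ S, J.graph.Adj a b → y ∈ J.half a b := by
  refine ⟨fun hy a ha b hb h => hS.subset_half ha hb h hy, ?_⟩
  generalize J.way y s = p
  induction p with
  | nil => exact fun _ => hs
  | @cons y z s hyz q ih =>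
    intro hy
    by_contra hyS
    have hz : z ∈ S := by
      refine ih hs fun a ha b hb h => ?_
      by_contra hn
      exact hyS ((eq_of_adj_half h hyz (hy a ha b hb h) hn).1 ▸ ha)
    exact (notMem_half hyz.symm).2 (mem_half_self hyz) (hy z hz y hyS hyz.symm)

lemma IsBranch.exists_eq_half {S : Set V} {u : V} (hS : J.IsBranch S u) :
    ∃ v, J.graph.Adj u v ∧ S = J.half u v := by
  obtain ⟨hS, v, hv⟩ := hS
  have hmem : ∀ a b, (a ∈ S ∧ b ∉ S ∧ J.graph.Adj a b) ↔ (a = u ∧ b = v) := by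
    intro a b
    have := Set.ext_iff.1 hv (a, b)
    simpa using this
  obtain ⟨hu, hvS, h⟩ := (hmem u v).2 ⟨rfl, rfl⟩
  refine ⟨v, h, Subset.antisymm (hS.subset_half hu hvS h) fun y hy => ?_⟩
  refine (hS.mem_iff hu y).2 fun a ha b hb hab => ?_
  obtain ⟨rfl, rfl⟩ := (hmem a b).1 ⟨ha, hb, hab⟩
  exact hy

/-- The branch `outer ξ u` is a half-tree not containing `ξ`. -/
lemma exists_outer_eq_half {ξ u : V} (hu : u ≠ ξ) :
    ∃ p, J.graph.Adj u p ∧ p ∈ (J.way u ξ).support ∧ ξ ∈ J.half p u ∧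
      J.outer ξ u = J.half u p := by
  obtain ⟨p, hp, e⟩ := J.exists_parent hu
  have hlt : J.rho ξ p < J.rho ξ u := by
    rw [J.rho_comm ξ u, J.rho_eq (J.way_isPath u ξ), e, J.rho_comm ξ p,
      J.rho_eq (J.way_isPath p ξ)]
    simp [len_pos_of_adj hp]
  have hξ := mem_half_of_rho_lt hp.symm hlt
  refine ⟨p, hp, by rw [e]; simp, hξ, Subset.antisymm ?_ ?_⟩
  · rintro a ⟨S, ⟨hS, hξS⟩, ha⟩
    obtain ⟨v, hv, rfl⟩ := hS.exists_eq_half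
    have := rho_lt_of_mem_half hv.symm ((notMem_half hv).1 hξS)
    rwa [J.closer_unique hp hv hlt this]
  · exact fun a ha => ⟨_, ⟨isBranch_half hp, (notMem_half hp).2 hξ⟩, ha⟩

lemma mem_outer_iff {ξ u a : V} (hu : u ≠ ξ) :
    a ∈ J.outer ξ u ↔ J.rho ξ a = J.rho ξ u + J.rho u a := by
  obtain ⟨p, hp, -, hξ, e⟩ := exists_outer_eq_half (J := J) hu
  rw [e]
  refine ⟨fun ha => rho_across' hp.symm hξ ha, fun ha => ?_⟩
  by_contra hn
  have h1 := (notMem_half hp).1 hn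
  have h2 : J.rho a u = J.rho a p + J.len s(p, u) := h1
  have h3 : J.rho ξ u = J.rho ξ p + J.len s(p, u) := hξ
  have h4 := J.rho_triangle ξ p a
  have h5 := len_pos_of_adj hp.symm
  rw [J.rho_comm u a] at ha
  rw [J.rho_comm p a] at h4
  linarith

lemma mem_outer_of_step {ξ u a b : V} (hu : u ≠ ξ) (ha : a ∈ J.outer ξ u)
    (hb : J.rho ξ b = J.rho ξ a + J.rho a b) : b ∈ J.outer ξ u := by
  rw [mem_outer_iff hu] at *
  have h1 := J.rho_triangle u a b
  have h2 := J.rho_triangle ξ u b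
  linarith

/-! ### Boundedness of the operators -/

lemma norm_e (lam : Ioo (0 : ℝ) 1) (a : V) : ‖J.e lam a‖ = 1 := by
  have h := J.inner_e lam a a
  rw [real_inner_self_eq_norm_sq, rho_self, Real.rpow_zero] at h
  exact (pow_eq_one_iff_of_nonneg (norm_nonneg _) two_ne_zero).1 h

/-- The vector of the Hilbert space given by a formal finite combination of the vertices. -/
def toH (J : MetricTree V) (lam : Ioo (0 : ℝ) 1) : (V →₀ ℝ) →ₗ[ℝ] J.H lam :=
  Finsupp.linearCombination ℝ (J.e lam)

lemma toH_single (lam : Ioo (0 : ℝ) 1) (a : V) (t : ℝ) :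
    J.toH lam (Finsupp.single a t) = t • J.e lam a := by
  simp [toH]

lemma denseRange_toH (lam : Ioo (0 : ℝ) 1) : DenseRange (J.toH lam) := by
  have h := J.span_e lam
  rwa [← Finsupp.range_linearCombination] at h

lemma inner_linearCombination (lam : Ioo (0 : ℝ) 1) (φ ψ : V → V) (x y : V →₀ ℝ) :
    inner ℝ (Finsupp.linearCombination ℝ (J.e lam ∘ φ) x)
      (Finsupp.linearCombination ℝ (J.e lam ∘ ψ) y) =
      ∑ a ∈ x.support, ∑ b ∈ y.support, x a * y b * (lam : ℝ) ^ J.rho (φ a) (ψ b) := by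
  rw [Finsupp.linearCombination_apply, Finsupp.linearCombination_apply, Finsupp.sum, Finsupp.sum,
    sum_inner]
  refine Finset.sum_congr rfl fun a _ => ?_
  rw [inner_sum]
  refine Finset.sum_congr rfl fun b _ => ?_
  rw [real_inner_smul_left, real_inner_smul_right, Function.comp_apply, Function.comp_apply,
    inner_e, mul_assoc]

lemma inner_toH_e (lam : Ioo (0 : ℝ) 1) (x : V →₀ ℝ) (b : V) :
    inner ℝ (J.toH lam x) (J.e lam b) = ∑ a ∈ x.support, x a * (lam : ℝ) ^ J.rho a b := by
  rw [toH, Finsupp.linearCombination_apply, Finsupp.sum, sum_inner]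
  refine Finset.sum_congr rfl fun a _ => ?_
  rw [real_inner_smul_left, inner_e]

/-- The angle between the subspaces of the two half-trees of an edge is bounded away from zero,
as the scalar products pass through the ends of the edge. -/
lemma abs_inner_toH_le (lam : Ioo (0 : ℝ) 1) {u v : V} (h : J.graph.Adj u v) {x y : V →₀ ℝ}
    (hx : ∀ a ∈ x.support, a ∈ J.half u v) (hy : ∀ b ∈ y.support, b ∈ J.half v u) :
    |inner ℝ (J.toH lam x) (J.toH lam y)| ≤
      (lam : ℝ) ^ J.len s(u, v) * (‖J.toH lam x‖ * ‖J.toH lam y‖) := by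
  have h0 : (0 : ℝ) < lam := lam.2.1
  have key : inner ℝ (J.toH lam x) (J.toH lam y) = (lam : ℝ) ^ J.len s(u, v) *
      (inner ℝ (J.toH lam x) (J.e lam u) * inner ℝ (J.toH lam y) (J.e lam v)) := by
    rw [inner_toH_e, inner_toH_e, Finset.sum_mul_sum, Finset.mul_sum]
    have := inner_linearCombination (J := J) lam id id x y
    refine this.trans (Finset.sum_congr rfl fun a ha => ?_)
    rw [Finset.mul_sum]
    refine Finset.sum_congr rfl fun b hb => ?_
    rw [id, id, rho_across h (hx a ha) (hy b hb), Real.rpow_add h0, Real.rpow_add h0,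
      J.rho_comm v b]
    ring
  have hl : (0 : ℝ) ≤ (lam : ℝ) ^ J.len s(u, v) := Real.rpow_nonneg h0.le _
  have hu := abs_real_inner_le_norm (J.toH lam x) (J.e lam u)
  have hv := abs_real_inner_le_norm (J.toH lam y) (J.e lam v)
  rw [norm_e, mul_one] at hu hv
  rw [key, abs_mul, abs_mul, abs_of_nonneg hl]
  gcongr

/-- The cutting of formal combinations to `S` is bounded in the norm of the Hilbert space. -/
def CutBounded (J : MetricTree V) (lam : Ioo (0 : ℝ) 1) (S : Set V) : Prop :=
  ∃ C, 0 ≤ C ∧ ∀ (_ : DecidablePred (· ∈ S)) (x : V →₀ ℝ),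
    ‖J.toH lam (x.filter (· ∈ S))‖ ≤ C * ‖J.toH lam x‖

lemma cutBounded_half (lam : Ioo (0 : ℝ) 1) {u v : V} (h : J.graph.Adj u v) :
    J.CutBounded lam (J.half u v) := by
  classical
  set c : ℝ := (lam : ℝ) ^ J.len s(u, v) with hc
  have hc1 : c < 1 := Real.rpow_lt_one lam.2.1.le lam.2.2 (len_pos_of_adj h)
  have hc0 : 0 ≤ c := Real.rpow_nonneg lam.2.1.le _
  refine ⟨√(1 - c)⁻¹, Real.sqrt_nonneg _, fun _ x => ?_⟩
  set y := J.toH lam (x.filter (· ∈ J.half u v)) with hy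
  set z := J.toH lam (x.filter (¬ · ∈ J.half u v)) with hz
  have hxyz : J.toH lam x = y + z := by
    rw [hy, hz, ← map_add, Finsupp.filter_add_filter_not]
  have hin : |inner ℝ y z| ≤ c * (‖y‖ * ‖z‖) := by
    refine abs_inner_toH_le lam h (fun a ha => ?_) (fun b hb => ?_)
    · rw [Finsupp.support_filter, Finset.mem_filter] at ha
      exact ha.2
    · rw [Finsupp.support_filter, Finset.mem_filter] at hb
      exact (notMem_half h).1 hb.2
  have hsq : ‖J.toH lam x‖ ^ 2 = ‖y‖ ^ 2 + 2 * inner ℝ y z + ‖z‖ ^ 2 := by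
    rw [hxyz, norm_add_sq_real]
  have hmain : (1 - c) * ‖y‖ ^ 2 ≤ ‖J.toH lam x‖ ^ 2 := by
    have h1 := (abs_le.1 hin).1
    have h2 : c * (2 * (‖y‖ * ‖z‖)) ≤ c * (‖y‖ ^ 2 + ‖z‖ ^ 2) := by
      gcongr
      nlinarith [sq_nonneg (‖y‖ - ‖z‖)]
    have h3 : c * ‖z‖ ^ 2 ≤ 1 * ‖z‖ ^ 2 := by gcongr
    nlinarith
  have h1c : 0 < 1 - c := by linarith
  have : ‖y‖ ^ 2 ≤ (√(1 - c)⁻¹ * ‖J.toH lam x‖) ^ 2 := by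
    rw [mul_pow, Real.sq_sqrt (inv_nonneg.2 h1c.le), inv_mul_eq_div, le_div_iff₀ h1c]
    linarith
  exact (sq_le_sq₀ (norm_nonneg _) (by positivity)).1 this

lemma CutBounded.inter {lam : Ioo (0 : ℝ) 1} {S T : Set V} (hS : J.CutBounded lam S)
    (hT : J.CutBounded lam T) : J.CutBounded lam (S ∩ T) := by
  classical
  obtain ⟨C, hC, h⟩ := hS
  obtain ⟨D, hD, k⟩ := hT
  refine ⟨D * C, mul_nonneg hD hC, fun _ x => ?_⟩
  have e : x.filter (· ∈ S ∩ T) = (x.filter (· ∈ S)).filter (· ∈ T) := by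
    ext a
    by_cases h1 : a ∈ S <;> by_cases h2 : a ∈ T <;> simp [h1, h2]
  calc _ = ‖J.toH lam ((x.filter (· ∈ S)).filter (· ∈ T))‖ := by rw [← e]
    _ ≤ D * ‖J.toH lam (x.filter (· ∈ S))‖ := k _ _
    _ ≤ D * (C * ‖J.toH lam x‖) := by gcongr; exact h _ x
    _ = D * C * ‖J.toH lam x‖ := by ring

lemma cutBounded_univ (lam : Ioo (0 : ℝ) 1) : J.CutBounded lam univ := by
  refine ⟨1, zero_le_one, fun _ x => ?_⟩
  rw [one_mul, (Finsupp.filter_eq_self_iff _ _).2 (by simp)]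

lemma IsRight.cutBounded {S : Set V} (hS : J.IsRight S) (lam : Ioo (0 : ℝ) 1) :
    J.CutBounded lam S := by
  classical
  rcases S.eq_empty_or_nonempty with rfl | ⟨s, hs⟩
  · refine ⟨0, le_rfl, fun _ x => ?_⟩
    have : x.filter (· ∈ (∅ : Set V)) = 0 := (Finsupp.filter_eq_zero_iff _ _).2 (by simp)
    rw [this, map_zero, norm_zero, zero_mul]
  have e : S = ⋂ p ∈ {p : V × V | p.1 ∈ S ∧ p.2 ∉ S ∧ J.graph.Adj p.1 p.2}, J.half p.1 p.2 := by
    ext y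
    rw [hS.1.mem_iff hs y]
    simp only [mem_iInter, mem_ofPred_eq, Prod.forall]
    exact ⟨fun h a b hab => h a hab.1 b hab.2.1 hab.2.2, fun h a ha b hb hab => h a b ⟨ha, hb, hab⟩⟩
  have hadj : ∀ p ∈ {p : V × V | p.1 ∈ S ∧ p.2 ∉ S ∧ J.graph.Adj p.1 p.2},
    J.graph.Adj p.1 p.2 := fun p hp => hp.2.2
  rw [e]
  have hfin := hS.2
  generalize {p : V × V | p.1 ∈ S ∧ p.2 ∉ S ∧ J.graph.Adj p.1 p.2} = E at hadj hfin
  induction E, hfin using Set.Finite.induction_on with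
  | empty => simpa using cutBounded_univ lam
  | @insert p E _ _ ih =>
    rw [biInter_insert]
    exact (cutBounded_half lam (hadj p (mem_insert _ _))).inter
      (ih fun q hq => hadj q (mem_insert_of_mem _ hq))

variable {Γ : Type*} [Group Γ] {act : Γ →* J.Aut}

lemma norm_linearCombination_aut (lam : Ioo (0 : ℝ) 1) (γ : J.Aut) (x : V →₀ ℝ) :
    ‖Finsupp.linearCombination ℝ (J.e lam ∘ (γ : Equiv.Perm V)) x‖ = ‖J.toH lam x‖ := by
  have h1 := inner_linearCombination (J := J) lam (γ : Equiv.Perm V) (γ : Equiv.Perm V) x x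
  have h2 := inner_linearCombination (J := J) lam id id x x
  have hγ : ∀ a b, J.rho ((γ : Equiv.Perm V) a) ((γ : Equiv.Perm V) b) = J.rho a b := γ.2
  simp only [hγ] at h1
  have h3 := h1.trans h2.symm
  rw [real_inner_self_eq_norm_sq, real_inner_self_eq_norm_sq] at h3
  exact (sq_eq_sq₀ (norm_nonneg _) (norm_nonneg _)).1 h3

/-- A hierarchomorphism is an isometry on each of finitely many right subtrees, and the cutting to
each of them is bounded. -/
lemma HierO.exists_norm_le (lam : Ioo (0 : ℝ) 1) {g : Equiv.Perm V} (hg : g ∈ J.HierO act) :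
    ∃ C, ∀ x : V →₀ ℝ,
      ‖Finsupp.linearCombination ℝ (J.e lam ∘ g) x‖ ≤ C * ‖J.toH lam x‖ := by
  classical
  obtain ⟨ι, hι, S, γ, h1, h2, h3, h4⟩ := hg
  have := Fintype.ofFinite ι
  choose C hC hS using fun j => (h1 j).cutBounded lam
  refine ⟨∑ j, C j, fun x => ?_⟩
  have e : Finsupp.linearCombination ℝ (J.e lam ∘ g) x =
      ∑ j, Finsupp.linearCombination ℝ (J.e lam ∘ (act (γ j) : Equiv.Perm V))
        (x.filter (· ∈ S j)) := by
    induction x using Finsupp.induction_linear with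
    | zero => simp [Finsupp.filter_zero]
    | add x y hx hy => simp only [Finsupp.filter_add, map_add, Finset.sum_add_distrib, hx, hy]
    | single a t =>
      obtain ⟨i, hi⟩ := mem_iUnion.1 (h3 ▸ mem_univ a : a ∈ ⋃ j, S j)
      rw [Finset.sum_eq_single i]
      · rw [Finsupp.filter_single_of_pos (fun b => b ∈ S i) hi]
        simp [h4 i a hi]
      · intro j _ hj
        rw [Finsupp.filter_single_of_neg (fun b => b ∈ S j)
          fun hja => Set.disjoint_left.1 (h2 hj) hja hi, map_zero]
      · simp
  rw [e, Finset.sum_mul]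
  refine (norm_sum_le _ _).trans (Finset.sum_le_sum fun j _ => ?_)
  rw [norm_linearCombination_aut]
  exact hS j _ x

lemma eq_of_eq_on_e {lam : Ioo (0 : ℝ) 1} {A B : J.H lam →L[ℝ] J.H lam}
    (h : ∀ a, A (J.e lam a) = B (J.e lam a)) : A = B := by
  refine ContinuousLinearMap.ext_on (J.span_e lam) ?_
  rintro _ ⟨a, rfl⟩
  exact h a

variable (act) in
/-- The bounded operator of a hierarchomorphism `g`, with `e a ↦ e (g a)`. -/
def opU (lam : Ioo (0 : ℝ) 1) (g : J.HierO act) : J.H lam →L[ℝ] J.H lam :=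
  (Finsupp.linearCombination ℝ (J.e lam ∘ (g : Equiv.Perm V))).extendOfNorm (J.toH lam)

lemma opU_e (lam : Ioo (0 : ℝ) 1) (g : J.HierO act) (a : V) :
    opU act lam g (J.e lam a) = J.e lam ((g : Equiv.Perm V) a) := by
  have := LinearMap.extendOfNorm_eq (denseRange_toH lam) (HierO.exists_norm_le lam g.2)
    (Finsupp.single a 1)
  rw [toH_single, one_smul, Finsupp.linearCombination_single, one_smul] at this
  exact this

variable (act) in
/-- The representation of the group of hierarchomorphisms by the operators `opU`. -/
def repU (lam : Ioo (0 : ℝ) 1) : J.HierO act →* (J.H lam →L[ℝ] J.H lam) where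
  toFun := opU act lam
  map_one' := eq_of_eq_on_e fun a => by rw [opU_e]; rfl
  map_mul' g h := eq_of_eq_on_e fun a => by
    rw [opU_e, mul_apply_eq_comp, opU_e, opU_e]; rfl

lemma repU_e (lam : Ioo (0 : ℝ) 1) (g : J.HierO act) (a : V) :
    repU act lam g (J.e lam a) = J.e lam ((g : Equiv.Perm V) a) := opU_e lam g a

/-! ### Complete subtrees and their outer branches -/

lemma mem_bdry {R : Finset V} {u : V} :
    u ∈ J.bdry R ↔ u ∈ R ∧ ∃! b, J.graph.Adj u b ∧ b ∈ R := by
  classical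
  simp [bdry]

section

variable {ξ : V} {R : Finset V}

lemma IsComplete.ne (hR : J.IsComplete ξ R) {u : V} (hu : u ∈ J.bdry R) : u ≠ ξ := by
  rintro rfl
  exact hR.2.2.2 hu

lemma IsComplete.outer_inter (hR : J.IsComplete ξ R) {u a : V} (hu : u ∈ J.bdry R) (ha : a ∈ R)
    (hau : a ∈ J.outer ξ u) : a = u := by
  obtain ⟨p, hp, hps, -, e⟩ := exists_outer_eq_half (J := J) (hR.ne hu)
  obtain ⟨huR, b, -, hb⟩ := mem_bdry.1 hu
  have hpR : p ∈ R := isSubtree_iff.1 hR.1 u huR ξ hR.2.2.1 p hps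
  by_contra hne
  obtain ⟨q, hq, eq⟩ := J.exists_parent (Ne.symm hne)
  have hqR : q ∈ R := isSubtree_iff.1 hR.1 u huR a ha q (by rw [eq]; simp)
  obtain rfl : q = p := (hb q ⟨hq, hqR⟩).trans (hb p ⟨hp, hpR⟩).symm
  rw [e] at hau
  have h1 := rho_lt_of_mem_half hp hau
  rw [J.rho_comm a u, J.rho_eq (J.way_isPath u a), eq, J.rho_comm a q,
    J.rho_eq (J.way_isPath q a)] at h1
  have := len_pos_of_adj hp
  simp only [SimpleGraph.Walk.edges_cons, List.map_cons, List.sum_cons] at h1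
  linarith

lemma IsComplete.exists_mem_outer (hR : J.IsComplete ξ R) {a : V} (ha : a ∉ R) :
    ∃ u ∈ J.bdry R, a ∈ J.outer ξ u := by
  induction hn : (J.way a ξ).length generalizing a with
  | zero => exact absurd (SimpleGraph.Walk.eq_of_length_eq_zero hn ▸ hR.2.2.1) ha
  | succ n ih =>
    have hne : a ≠ ξ := fun h => ha (h ▸ hR.2.2.1)
    obtain ⟨p, hp, e⟩ := J.exists_parent hne
    have hstep : J.rho ξ a = J.rho ξ p + J.rho p a := by
      rw [J.rho_comm ξ a, J.rho_comm ξ p, J.rho_comm p a, J.rho_adj hp,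
        J.rho_eq (J.way_isPath a ξ), e, J.rho_eq (J.way_isPath p ξ)]
      simp [add_comm]
    by_cases hpR : p ∈ R
    · have hb : p ∈ J.bdry R :=
        mem_bdry.2 ⟨hpR, (hR.2.1 p hpR).resolve_left fun h => ha (h a hp.symm)⟩
      exact ⟨p, hb, (mem_outer_iff (hR.ne hb)).2 hstep⟩
    · obtain ⟨u, hu, hpu⟩ := ih hpR (by rw [e, SimpleGraph.Walk.length_cons] at hn; omega)
      exact ⟨u, hu, mem_outer_of_step (hR.ne hu) hpu hstep⟩

lemma IsComplete.outer_unique (hR : J.IsComplete ξ R) {u u' a : V} (hu : u ∈ J.bdry R)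
    (hu' : u' ∈ J.bdry R)
    (h : a ∈ J.outer ξ u) (h' : a ∈ J.outer ξ u') : u = u' := by
  obtain ⟨p, hp, -, hξ, e⟩ := exists_outer_eq_half (J := J) (hR.ne hu)
  by_contra hne
  have hu'h : u' ∈ J.half p u := by
    by_contra hn
    refine hne (hR.outer_inter hu (mem_bdry.1 hu').1 ?_).symm
    rw [e]
    exact (notMem_half hp.symm).1 hn
  refine hne (hR.outer_inter hu' (mem_bdry.1 hu).1 ?_)
  rw [mem_outer_iff (hR.ne hu')] at h' ⊢
  rw [e] at h
  have h1 := rho_across' hp.symm hξ h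
  have h2 := rho_across' hp.symm hu'h h
  linarith

/-- The branches at the boundary of `R` are viewed from a vertex of `R` through their roots. -/
lemma IsComplete.rho_outer (hR : J.IsComplete ξ R) {u a b : V} (hu : u ∈ J.bdry R) (hb : b ∈ R)
    (ha : a ∈ J.outer ξ u) : J.rho b a = J.rho b u + J.rho u a := by
  obtain ⟨p, hp, -, hξ, e⟩ := exists_outer_eq_half (J := J) (hR.ne hu)
  by_cases hbu : b ∈ J.outer ξ u
  · rw [hR.outer_inter hu hb hbu, rho_self, zero_add]
  · rw [e] at ha hbu
    exact rho_across' hp.symm ((notMem_half hp).1 hbu) ha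

end

lemma mem_outer_self {ξ u : V} (hu : u ≠ ξ) : u ∈ J.outer ξ u := by
  rw [mem_outer_iff hu, rho_self, add_zero]

variable {ξ : V} {R : ℕ → Finset V}

lemma IsExhaustion.eventually_mem (hR : J.IsExhaustion ξ R) (a : V) : ∀ᶠ j in atTop, a ∈ R j := by
  obtain ⟨i, hi⟩ := hR.2.2 a
  exact (eventually_ge_atTop i).mono fun j hj => hR.2.1 hj hi

lemma IsExhaustion.eventually_notMem_outer (hR : J.IsExhaustion ξ R) (hperfect : J.IsPerfect)
    (hfinite : J.IsLocallyFinite) (k : V) :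
    ∀ᶠ j in atTop, ∀ u ∈ J.bdry (R j), k ∉ J.outer ξ u := by
  have h1 : ∀ᶠ j in atTop, ∀ b ∈ J.graph.neighborSet k, b ∈ R j :=
    (eventually_all_finite (hfinite.1 k)).2 fun b _ => hR.eventually_mem b
  filter_upwards [h1, hR.eventually_mem k] with j hj hk u hu hku
  obtain rfl := (hR.1 j).outer_inter hu hk hku
  obtain ⟨b, -, hb⟩ := (mem_bdry.1 hu).2
  have h2 : (J.graph.neighborSet k).encard ≤ 1 :=
    encard_le_one_iff.2 fun c d hc hd => (hb c ⟨hc, hj c hc⟩).trans (hb d ⟨hd, hj d hd⟩).symm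
  exact absurd ((hperfect k).trans h2) (by norm_num)

/-- A hierarchomorphism `g` acts on the branches far away as an isometry, and their images are
viewed from a given vertex `b` through the images of their roots. -/
lemma IsExhaustion.eventually_rho (hR : J.IsExhaustion ξ R) (hperfect : J.IsPerfect)
    (hfinite : J.IsLocallyFinite) (g : J.HierO act) (b : V) :
    ∀ᶠ j in atTop, ∀ u ∈ J.bdry (R j), ∀ a ∈ J.outer ξ u,
      J.rho b ((g : Equiv.Perm V) a) = J.rho b ((g : Equiv.Perm V) u) + J.rho u a ∧
      ∀ a' ∈ J.outer ξ u,
        J.rho ((g : Equiv.Perm V) a) ((g : Equiv.Perm V) a') = J.rho a a' := by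
  obtain ⟨g, hg⟩ := g
  obtain ⟨ι, hι, S, γ, h1, h2, h3, h4⟩ := hg
  have hexit : ∀ᶠ j in atTop, ∀ i, ∀ q ∈ {p : V × V | p.1 ∈ S i ∧ p.2 ∉ S i ∧
      J.graph.Adj p.1 p.2}, ∀ u ∈ J.bdry (R j), q.1 ∉ J.outer ξ u :=
    eventually_all.2 fun i => (eventually_all_finite (h1 i).2).2 fun q _ =>
      hR.eventually_notMem_outer hperfect hfinite q.1
  filter_upwards [hexit, hR.eventually_notMem_outer hperfect hfinite (g⁻¹ b)]
    with j hj hb u hu a ha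
  obtain ⟨p, hp, -, hξ, e⟩ := exists_outer_eq_half (J := J) ((hR.1 j).ne hu)
  have huo := mem_outer_self (J := J) ((hR.1 j).ne hu)
  obtain ⟨i, hi⟩ := mem_iUnion.1 (h3 ▸ mem_univ u : u ∈ ⋃ i, S i)
  -- the branch contains no starting point of an edge leading out of `S i`
  have hsub : ∀ c ∈ J.outer ξ u, c ∈ S i := by
    intro c hc
    by_contra hcS
    obtain ⟨d, hd, hd1, hd2⟩ := (J.way u c).exists_boundary_dart (S i) hi hcS
    refine hj i (d.fst, d.snd) ⟨hd1, hd2, d.adj⟩ u hu ?_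
    have hsubt : J.IsSubtree (J.outer ξ u) := e ▸ isSubtree_half hp
    exact isSubtree_iff.1 hsubt u huo c hc _ ((J.way u c).dart_fst_mem_support_of_mem_darts hd)
  have hγ : ∀ c ∈ J.outer ξ u, g c = (act (γ i) : Equiv.Perm V) c := fun c hc =>
    h4 i c (hsub c hc)
  have hiso : ∀ c d, J.rho ((act (γ i) : Equiv.Perm V) c) ((act (γ i) : Equiv.Perm V) d) =
    J.rho c d := (act (γ i)).2
  refine ⟨?_, fun a' ha' => ?_⟩
  · obtain ⟨c, rfl⟩ := (act (γ i) : Equiv.Perm V).surjective b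
    have hc : c ∉ J.outer ξ u := by
      intro hc
      refine hb u hu ?_
      rwa [← hγ c hc, Equiv.Perm.inv_def, Equiv.symm_apply_apply]
    rw [hγ a ha, hγ u huo, hiso, hiso]
    rw [e] at hc ha
    exact rho_across' hp.symm ((notMem_half hp).1 hc) ha
  · rw [hγ a ha, hγ a' ha', hiso]

/-! ### The balls at the boundary of a complete subtree -/

lemma mem_absOf_iff {S : Set V} {r : J.Ray} : r.toAbs ∈ J.absOf S ↔ ∀ᶠ M in atTop, r M ∈ S := by
  constructor
  · rintro ⟨s, hs, hS⟩
    obtain ⟨m, n, h⟩ := Quotient.exact hs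
    filter_upwards [eventually_ge_atTop n] with M hM
    have := h (M - n)
    rw [Nat.sub_add_cancel hM] at this
    exact this ▸ hS _
  · intro h
    obtain ⟨N, hN⟩ := eventually_atTop.1 h
    exact ⟨r.tail N, Ray.toAbs_tail J r N, fun n => hN _ (Nat.le_add_left _ _)⟩

lemma exists_ray (ω : J.Abs) : ∃ r : J.Ray, r.toAbs = ω := Quotient.exists_rep ω

lemma IsComplete.exists_mem_absOf {R : Finset V} (hR : J.IsComplete ξ R) (ω : J.Abs) :
    ∃ u ∈ J.bdry R, ω ∈ J.absOf (J.outer ξ u) := by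
  obtain ⟨r, rfl⟩ := exists_ray ω
  obtain ⟨N, hN⟩ := r.eventually_away J ξ
  have hout : ∀ᶠ M in atTop, r M ∉ R := by
    rw [← Nat.cofinite_eq_atTop]
    exact r.inj.tendsto_cofinite.eventually R.finite_toSet.compl_mem_cofinite
  obtain ⟨M, hM, hMN⟩ := (hout.and (eventually_ge_atTop N)).exists
  obtain ⟨u, hu, hMu⟩ := hR.exists_mem_outer hM
  refine ⟨u, hu, mem_absOf_iff.2 ?_⟩
  filter_upwards [eventually_ge_atTop M] with K hK
  induction K, hK using Nat.le_induction with
  | base => exact hMu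
  | succ K hK ih =>
    exact mem_outer_of_step (hR.ne hu) ih (by rw [J.rho_adj (r.adj K)]; exact hN K (by omega))

lemma IsComplete.absOf_unique {R : Finset V} (hR : J.IsComplete ξ R) {ω : J.Abs} {u u' : V}
    (hu : u ∈ J.bdry R) (hu' : u' ∈ J.bdry R) (h : ω ∈ J.absOf (J.outer ξ u))
    (h' : ω ∈ J.absOf (J.outer ξ u')) : u = u' := by
  obtain ⟨r, rfl⟩ := exists_ray ω
  obtain ⟨M, h1, h2⟩ := ((mem_absOf_iff.1 h).and (mem_absOf_iff.1 h')).exists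
  exact hR.outer_unique hu hu' h1 h2

lemma isOpen_absOf_outer {u : V} (hu : u ≠ ξ) : IsOpen (J.absOf (J.outer ξ u)) := by
  obtain ⟨p, hp, -, -, e⟩ := exists_outer_eq_half (J := J) hu
  exact TopologicalSpace.isOpen_generateFrom_of_mem ⟨_, u, e ▸ isBranch_half hp, rfl⟩

variable (ξ) in
lemma exists_horo (g : J.HierO act) (b : V) (ω : J.Abs) :
    ∃ c : ℝ, ∀ r : J.Ray, r.toAbs = ω →
      ∀ᶠ M in atTop, J.rho b ((g : Equiv.Perm V) (r M)) - J.rho ξ (r M) = c := by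
  obtain ⟨c, hc⟩ := J.exists_pseudoderiv act ξ g ω
  obtain ⟨s, s', hs, -, hss'⟩ := J.absMap_spec act g ω
  obtain ⟨d, hd⟩ := s'.eventually_diff J b ξ
  refine ⟨d - c, fun r hr => ?_⟩
  obtain ⟨m, n, e⟩ := Quotient.exact (hr.trans hs.symm)
  filter_upwards [hc r hr, (tendsto_sub_atTop_nat m |>.eventually
    ((tendsto_add_atTop_nat n).eventually hd)), eventually_ge_atTop m] with M h1 h2 h3
  rw [hss', ← e, Nat.sub_add_cancel h3] at h2
  linarith

variable (ξ) in
/-- The eventual value of `rho b (g (a M)) - rho ξ (a M)` along the rays `a` leading to `ω`. For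
`g = 1` it is the Busemann function of `ω`, and for `b = ξ` minus the pseudoderivative of `g`. -/
def horo (g : J.HierO act) (b : V) (ω : J.Abs) : ℝ := (exists_horo ξ g b ω).choose

lemma eventually_horo (g : J.HierO act) (b : V) (r : J.Ray) :
    ∀ᶠ M in atTop, J.rho b ((g : Equiv.Perm V) (r M)) - J.rho ξ (r M) = horo ξ g b r.toAbs :=
  (exists_horo ξ g b r.toAbs).choose_spec r rfl

lemma eventually_pseudoderiv (g : J.HierO act) (r : J.Ray) :
    ∀ᶠ M in atTop, J.rho ξ (r M) - J.rho ξ ((g : Equiv.Perm V) (r M)) =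
      J.pseudoderiv act ξ g r.toAbs :=
  (J.exists_pseudoderiv act ξ g r.toAbs).choose_spec r rfl

lemma pseudoderiv_eq_neg_horo (g : J.HierO act) (ω : J.Abs) :
    J.pseudoderiv act ξ g ω = -horo ξ g ξ ω := by
  obtain ⟨r, rfl⟩ := exists_ray ω
  obtain ⟨M, h1, h2⟩ := ((eventually_horo (ξ := ξ) g ξ r).and (eventually_pseudoderiv g r)).exists
  linarith

lemma exists_ray_toHier (g : J.HierO act) (ω : J.Abs) : ∃ r r' : J.Ray, r.toAbs = ω ∧
    r'.toAbs = J.toHier act g ω ∧ ∀ i, r' i = (g : Equiv.Perm V) (r i) :=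
  J.absMap_spec act g ω

/-- The cocycle identity. -/
lemma horo_mul (g h : J.HierO act) (b : V) (ω : J.Abs) :
    horo ξ (g * h) b ω = horo ξ g b (J.toHier act h ω) + horo ξ h ξ ω := by
  obtain ⟨r, r', rfl, hr', e⟩ := exists_ray_toHier h ω
  obtain ⟨M, ⟨h1, h2⟩, h3⟩ := (((eventually_horo (ξ := ξ) (g * h) b r).and
    (eventually_horo (ξ := ξ) g b r')).and (eventually_horo (ξ := ξ) h ξ r)).exists
  rw [hr', e] at h2
  rw [← h1, ← h2, ← h3, Subgroup.coe_mul, Equiv.Perm.mul_apply]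
  ring

lemma horo_eq_of_mem {g : J.HierO act} {b u : V}
    (h : ∀ a ∈ J.outer ξ u, J.rho b ((g : Equiv.Perm V) a) =
      J.rho b ((g : Equiv.Perm V) u) + J.rho u a) (hu : u ≠ ξ) {ω : J.Abs}
    (hω : ω ∈ J.absOf (J.outer ξ u)) :
    horo ξ g b ω = J.rho b ((g : Equiv.Perm V) u) - J.rho ξ u := by
  obtain ⟨r, rfl⟩ := exists_ray ω
  obtain ⟨M, h1, h2⟩ := ((eventually_horo (ξ := ξ) g b r).and (mem_absOf_iff.1 hω)).exists
  rw [← h1, h _ h2, (mem_outer_iff hu).1 h2]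
  ring

lemma IsExhaustion.eventually_horo_eq (hR : J.IsExhaustion ξ R) (hperfect : J.IsPerfect)
    (hfinite : J.IsLocallyFinite) (g : J.HierO act) (b : V) :
    ∀ᶠ j in atTop, ∀ u ∈ J.bdry (R j), ∀ ω ∈ J.absOf (J.outer ξ u),
      horo ξ g b ω = J.rho b ((g : Equiv.Perm V) u) - J.rho ξ u := by
  filter_upwards [hR.eventually_rho hperfect hfinite g b] with j hj u hu ω hω
  exact horo_eq_of_mem (fun a ha => (hj u hu a ha).1) ((hR.1 j).ne hu) hω

/-- Hierarchomorphisms act on the absolute by continuous maps: far away, a branch is mapped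
into a given half-tree or into the complementary one. -/
lemma continuous_toHier (hR : J.IsExhaustion ξ R) (hperfect : J.IsPerfect)
    (hfinite : J.IsLocallyFinite) (g : J.HierO act) : Continuous (J.toHier act g) := by
  refine continuous_generateFrom_iff.2 ?_
  rintro _ ⟨S, s, hS, rfl⟩
  obtain ⟨t, hst, rfl⟩ := hS.exists_eq_half
  obtain ⟨j, hs, ht⟩ := ((hR.eventually_rho hperfect hfinite g s).and
    (hR.eventually_rho hperfect hfinite g t)).exists
  have hiff : ∀ u ∈ J.bdry (R j), ∀ ω ∈ J.absOf (J.outer ξ u),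
      J.toHier act g ω ∈ J.absOf (J.half s t) ↔ (g : Equiv.Perm V) u ∈ J.half s t := by
    intro u hu ω hω
    obtain ⟨r, r', rfl, hr', e⟩ := exists_ray_toHier g ω
    have hmem : ∀ a ∈ J.outer ξ u,
        ((g : Equiv.Perm V) a ∈ J.half s t ↔ (g : Equiv.Perm V) u ∈ J.half s t) := by
      intro a ha
      have h1 := (hs u hu a ha).1
      have h2 := (ht u hu a ha).1
      simp only [half, mem_ofPred_eq]
      rw [J.rho_comm _ s, J.rho_comm _ t, J.rho_comm _ s, J.rho_comm _ t, h1, h2]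
      constructor <;> intro h <;> linarith
    rw [← hr', mem_absOf_iff]
    have hev := mem_absOf_iff.1 hω
    constructor
    · intro h
      obtain ⟨M, h1, h2⟩ := (h.and hev).exists
      rw [e] at h1
      exact (hmem _ h2).1 h1
    · intro h
      filter_upwards [hev] with M hM
      rw [e]
      exact (hmem _ hM).2 h
  refine isOpen_iff_forall_mem_open.2 fun ω hω => ?_
  obtain ⟨u, hu, hωu⟩ := (hR.1 j).exists_mem_absOf ω
  exact ⟨_, fun ω' hω' => (hiff u hu ω' hω').2 ((hiff u hu ω hωu).1 hω),
    isOpen_absOf_outer ((hR.1 j).ne hu), hωu⟩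

/-! ### Hierarchomorphisms that act trivially on the absolute -/

lemma exists_two_children (hperfect : J.IsPerfect) (ξ a : V) :
    ∃ c c' : V, c ≠ c' ∧ (J.graph.Adj a c ∧ J.rho ξ c = J.rho ξ a + J.rho a c) ∧
      (J.graph.Adj a c' ∧ J.rho ξ c' = J.rho ξ a + J.rho a c') := by
  set F : Set V := {c | J.graph.Adj a c ∧ J.rho ξ a = J.rho ξ c + J.len s(a, c)}
  have hF : F.encard ≤ 1 := by
    refine encard_le_one_iff.2 fun c d hc hd => J.closer_unique hc.1 hd.1 (ξ := ξ) ?_ ?_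
    · have := hc.2; have := len_pos_of_adj hc.1; linarith
    · have := hd.2; have := len_pos_of_adj hd.1; linarith
  have h1 : 1 < (J.graph.neighborSet a \ F).encard := by
    have h2 := encard_sdiff_add_encard_inter (J.graph.neighborSet a) F
    have h3 : (J.graph.neighborSet a ∩ F).encard ≤ 1 :=
      (encard_le_encard inter_subset_right).trans hF
    by_contra hcon
    have h4 := (hperfect a).trans (h2 ▸ add_le_add (not_lt.1 hcon) h3)
    exact absurd h4 (by norm_num)
  obtain ⟨c, c', hc, hc', hne⟩ := one_lt_encard_iff.1 h1
  have key : ∀ d ∈ J.graph.neighborSet a \ F, J.graph.Adj a d ∧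
      J.rho ξ d = J.rho ξ a + J.rho a d := by
    rintro d ⟨hd, hdF⟩
    refine ⟨hd, ?_⟩
    rw [J.rho_adj hd]
    exact (J.rho_step ξ hd).resolve_right fun h => hdF ⟨hd, h⟩
  exact ⟨c, c', hne, key c hc, key c' hc'⟩

lemma exists_ray_outer (hperfect : J.IsPerfect) {ξ c : V} (hc : c ≠ ξ) :
    ∃ r : J.Ray, ∀ n, r n ∈ J.outer ξ c := by
  choose s hs using fun a => (exists_two_children hperfect ξ a)
  choose t hst hs ht using hs
  have hlt : StrictMono fun n => J.rho ξ (s^[n] c) := by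
    refine strictMono_nat_of_lt_succ fun n => ?_
    rw [Function.iterate_succ_apply', (hs _).2]
    have := J.rho_pos (hs (s^[n] c)).1.ne
    linarith
  refine ⟨⟨fun n => s^[n] c, fun m n h => hlt.injective (congrArg (J.rho ξ) h), fun n => ?_⟩,
    fun n => ?_⟩
  · rw [Function.iterate_succ_apply']
    exact (hs _).1
  · change s^[n] c ∈ _
    induction n with
    | zero => exact mem_outer_self hc
    | succ n ih =>
      rw [Function.iterate_succ_apply']
      exact mem_outer_of_step hc ih (hs _).2

/-- For every vertex `u` there are two points of the absolute whose Gromov product seen from `ξ`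
equals `rho ξ u`. -/
lemma exists_two_rays (hperfect : J.IsPerfect) {ξ u : V} (hu : u ≠ ξ) :
    ∃ r s : J.Ray, (∀ n, r n ∈ J.outer ξ u) ∧ (∀ n, s n ∈ J.outer ξ u) ∧
      ∀ m n, J.rho (r m) (s n) = J.rho u (r m) + J.rho u (s n) := by
  obtain ⟨c, c', hne, ⟨hc, hcξ⟩, ⟨hc', hcξ'⟩⟩ := exists_two_children hperfect ξ u
  have hpos : ∀ d, J.graph.Adj u d → J.rho ξ d = J.rho ξ u + J.rho u d →
      J.rho ξ u < J.rho ξ d ∧ d ≠ ξ := by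
    intro d hd h
    have h1 := J.rho_pos hd.ne
    refine ⟨by linarith, ?_⟩
    rintro rfl
    have := J.rho_nonneg d u
    rw [rho_self] at h
    linarith
  have houter : ∀ d, J.graph.Adj u d → J.rho ξ d = J.rho ξ u + J.rho u d →
      J.outer ξ d = J.half d u := by
    intro d hd h
    obtain ⟨p, hp, -, hξ, e⟩ := exists_outer_eq_half (J := J) (hpos d hd h).2
    rw [e, J.closer_unique hp hd.symm (rho_lt_of_mem_half hp.symm hξ) (hpos d hd h).1]
  have hsub : ∀ d, J.graph.Adj u d → J.rho ξ d = J.rho ξ u + J.rho u d →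
      ∀ a ∈ J.outer ξ d, a ∈ J.outer ξ u := by
    intro d hd h a ha
    refine (mem_outer_iff hu).2 ?_
    have h1 := ha
    rw [houter d hd h] at h1
    have h2 := rho_across' hd (mem_half_self hd) h1
    have h3 := (mem_outer_iff (hpos d hd h).2).1 ha
    linarith
  obtain ⟨r, hr⟩ := exists_ray_outer hperfect (hpos c hc hcξ).2
  obtain ⟨s, hs⟩ := exists_ray_outer hperfect (hpos c' hc' hcξ').2
  refine ⟨r, s, fun n => hsub c hc hcξ _ (hr n), fun n => hsub c' hc' hcξ' _ (hs n),
    fun m n => ?_⟩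
  have h1 := hr m
  have h2 := hs n
  rw [houter c hc hcξ] at h1
  rw [houter c' hc' hcξ'] at h2
  have h3 : s n ∈ J.half u c := by
    by_contra hn
    have h4 := (notMem_half hc).1 hn
    exact hne (J.closer_unique (ξ := s n) hc hc' (rho_lt_of_mem_half hc.symm h4)
      (rho_lt_of_mem_half hc'.symm h2))
  rw [rho_across' hc.symm h1 h3, J.rho_comm u (r m)]

lemma exists_shift_of_toHier_eq_one {k : J.HierO act} (hk : J.toHier act k = 1) (r : J.Ray) :
    ∃ m n, ∀ i, (k : Equiv.Perm V) (r (i + m)) = r (i + n) := by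
  obtain ⟨s, s', hs, hs', e⟩ := exists_ray_toHier k r.toAbs
  rw [hk] at hs'
  obtain ⟨m, n, h⟩ := Quotient.exact hs
  obtain ⟨m', n', h'⟩ := Quotient.exact hs'
  refine ⟨n + m', n' + m, fun i => ?_⟩
  have h1 : s' (i + m + m') = r (i + m + n') := h' (i + m)
  have h2 : s (i + m' + m) = r (i + m' + n) := h (i + m')
  rw [show i + (n + m') = i + m' + n by ring, ← h2, show i + (n' + m) = i + m + n' by ring, ← h1,
    e, show i + m + m' = i + m' + m by ring]

/-- A hierarchomorphism that acts trivially on the absolute preserves the distance to `ξ` far away,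
because this distance is a Gromov product of two points of the absolute. -/
lemma horo_eq_zero_of_toHier_eq_one (hR : J.IsExhaustion ξ R) (hperfect : J.IsPerfect)
    (hfinite : J.IsLocallyFinite) {k : J.HierO act} (hk : J.toHier act k = 1) (ω : J.Abs) :
    horo ξ k ξ ω = 0 := by
  obtain ⟨j, hj⟩ := (hR.eventually_rho hperfect hfinite k ξ).exists
  obtain ⟨u, hu, hωu⟩ := (hR.1 j).exists_mem_absOf ω
  have hne := (hR.1 j).ne hu
  rw [horo_eq_of_mem (fun a ha => (hj u hu a ha).1) hne hωu]
  obtain ⟨r, s, hr, hs, hrs⟩ := exists_two_rays hperfect hne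
  obtain ⟨m, n, hm⟩ := exists_shift_of_toHier_eq_one hk r
  obtain ⟨m', n', hm'⟩ := exists_shift_of_toHier_eq_one hk s
  have hx := (hj u hu _ (hr (0 + m))).1
  have hy := (hj u hu _ (hs (0 + m'))).1
  have hxy := (hj u hu _ (hr (0 + m))).2 _ (hs (0 + m'))
  rw [hm] at hx
  rw [hm'] at hy
  rw [hm, hm', hrs, hrs] at hxy
  rw [(mem_outer_iff hne).1 (hr _)] at hx
  rw [(mem_outer_iff hne).1 (hs _)] at hy
  linarith

lemma horo_eq_of_toHier_eq (hR : J.IsExhaustion ξ R) (hperfect : J.IsPerfect)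
    (hfinite : J.IsLocallyFinite) {g h : J.HierO act} (hgh : J.toHier act g = J.toHier act h)
    (ω : J.Abs) : horo ξ g ξ ω = horo ξ h ξ ω := by
  have hk : J.toHier act (h⁻¹ * g) = 1 := by rw [map_mul, map_inv, hgh, inv_mul_cancel]
  have := horo_mul (ξ := ξ) h (h⁻¹ * g) ξ ω
  rw [mul_inv_cancel_left, horo_eq_zero_of_toHier_eq_one hR hperfect hfinite hk, hk] at this
  simpa using this

lemma pseudoderiv_eq_of_toHier_eq (hR : J.IsExhaustion ξ R) (hperfect : J.IsPerfect)
    (hfinite : J.IsLocallyFinite) {g h : J.HierO act} (hgh : J.toHier act g = J.toHier act h) :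
    J.pseudoderiv act ξ g = J.pseudoderiv act ξ h := by
  funext ω
  rw [pseudoderiv_eq_neg_horo, pseudoderiv_eq_neg_horo,
    horo_eq_of_toHier_eq hR hperfect hfinite hgh]

/-! ### The vectors of complete subtrees and their scalar products -/

/-- The integral of a function on the absolute against a charge. -/
def chargeIntegral (μ : SignedMeasure J.Abs) (F : J.Abs → ℝ) : ℝ :=
  μ.integral F (ContinuousLinearMap.lsmul ℝ ℝ)

lemma IsComplete.pairwise_disjoint {R : Finset V} (hR : J.IsComplete ξ R) :
    (J.bdry R : Set V).Pairwise (Function.onFun Disjoint fun u => J.absOf (J.outer ξ u)) := by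
  intro u hu v hv hne
  exact Set.disjoint_left.2 fun ω h h' => hne (hR.absOf_unique hu hv h h')

lemma IsComplete.measurableSet {R : Finset V} (hR : J.IsComplete ξ R) :
    ∀ u ∈ J.bdry R, MeasurableSet (J.absOf (J.outer ξ u)) := fun _ hu =>
  (isOpen_absOf_outer (hR.ne hu)).measurableSet

lemma IsComplete.chargeIntegral_eq {R : Finset V} (hR : J.IsComplete ξ R)
    (μ : SignedMeasure J.Abs) {F : J.Abs → ℝ} {c : V → ℝ}
    (hF : ∀ u ∈ J.bdry R, ∀ ω ∈ J.absOf (J.outer ξ u), F ω = c u) :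
    chargeIntegral μ F = ∑ u ∈ J.bdry R, c u * μ (J.absOf (J.outer ξ u)) :=
  VectorMeasure.integral_of_partition μ hR.measurableSet hR.pairwise_disjoint
    hR.exists_mem_absOf hF

variable {lam : Ioo (0 : ℝ) 1}

/-- The scalar products of `U g (Ψ[μ|R])` with the vectors `e b` are integrals against `μ`. -/
lemma IsComplete.inner_repU_psi {R : Finset V} (hR : J.IsComplete ξ R) (g : J.HierO act) (b : V)
    (μ : SignedMeasure J.Abs) (h : ∀ u ∈ J.bdry R, ∀ ω ∈ J.absOf (J.outer ξ u),
      horo ξ g b ω = J.rho b ((g : Equiv.Perm V) u) - J.rho ξ u) :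
    inner ℝ (repU act lam g (J.psi lam ξ μ R)) (J.e lam b) =
      chargeIntegral μ fun ω => (lam : ℝ) ^ horo ξ g b ω := by
  rw [hR.chargeIntegral_eq μ (c := fun u =>
    (lam : ℝ) ^ (J.rho b ((g : Equiv.Perm V) u) - J.rho ξ u))
    fun u hu ω hω => by rw [h u hu ω hω]]
  rw [psi, map_sum, sum_inner]
  refine Finset.sum_congr rfl fun u _ => ?_
  rw [f, map_smul, map_smul, repU_e, real_inner_smul_left, real_inner_smul_left, inner_e,
    J.rho_comm _ b, sub_eq_add_neg, Real.rpow_add lam.2.1]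
  ring

variable (act) in
lemma IsComplete.inner_psi {R : Finset V} (hR : J.IsComplete ξ R) {b : V} (hb : b ∈ R)
    (μ : SignedMeasure J.Abs) : inner ℝ (J.psi lam ξ μ R) (J.e lam b) =
      chargeIntegral μ fun ω => (lam : ℝ) ^ horo ξ (1 : J.HierO act) b ω := by
  have := hR.inner_repU_psi (lam := lam) (1 : J.HierO act) b μ fun u hu ω hω =>
    horo_eq_of_mem (fun a ha => hR.rho_outer hu hb ha) (hR.ne hu) hω
  rwa [map_one] at this

/-- The integral against `T(g) μ` in terms of the integral against `μ`. -/
lemma chargeIntegral_T (hR : J.IsExhaustion ξ R) (hperfect : J.IsPerfect)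
    (hfinite : J.IsLocallyFinite) (g : J.HierO act) (b : V) (μ : SignedMeasure J.Abs) :
    chargeIntegral (J.T act lam ξ g μ) (fun ω => (lam : ℝ) ^ horo ξ (1 : J.HierO act) b ω) =
      chargeIntegral μ fun ω => (lam : ℝ) ^ horo ξ g b ω := by
  set σ := J.toHier act g with hσ
  have hmeas : Measurable σ := (continuous_toHier hR hperfect hfinite g).measurable
  obtain ⟨j, h1, h2⟩ := ((hR.eventually_horo_eq hperfect hfinite (1 : J.HierO act) b).and
    (hR.eventually_horo_eq hperfect hfinite g⁻¹ ξ)).exists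
  set c : V → ℝ := fun u => (lam : ℝ) ^ (J.rho b u - J.rho ξ u)
  set d : V → ℝ := fun u =>
    (lam : ℝ) ^ (-(J.rho ξ (((g⁻¹ : J.HierO act) : Equiv.Perm V) u) - J.rho ξ u))
  have hF : ∀ u ∈ J.bdry (R j), ∀ ω ∈ J.absOf (J.outer ξ u),
      (lam : ℝ) ^ horo ξ (1 : J.HierO act) b ω = c u := fun u hu ω hω => by
    rw [h1 u hu ω hω]; rfl
  have hw : ∀ u ∈ J.bdry (R j), ∀ ω ∈ J.absOf (J.outer ξ u),
      (lam : ℝ) ^ J.pseudoderiv act ξ g⁻¹ ω = d u := fun u hu ω hω => by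
    rw [pseudoderiv_eq_neg_horo, h2 u hu ω hω]
  have hT : ∀ u ∈ J.bdry (R j), J.T act lam ξ g μ (J.absOf (J.outer ξ u)) =
      d u * μ (σ ⁻¹' J.absOf (J.outer ξ u)) := by
    intro u hu
    rw [T, weightedImage, VectorMeasure.withDensity_apply
      (VectorMeasure.integrable_of_partition _ (hR.1 j).measurableSet (hR.1 j).exists_mem_absOf hw),
      VectorMeasure.setIntegral_of_eqOn _ (hw u hu),
      VectorMeasure.map_apply _ hmeas ((hR.1 j).measurableSet u hu)]
  rw [(hR.1 j).chargeIntegral_eq _ hF]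
  -- the preimages of the balls form a partition adapted to the second integrand
  have hpre : chargeIntegral μ (fun ω => (lam : ℝ) ^ horo ξ g b ω) =
      ∑ u ∈ J.bdry (R j), (c u * d u) * μ (σ ⁻¹' J.absOf (J.outer ξ u)) := by
    refine VectorMeasure.integral_of_partition μ
      (fun u hu => hmeas ((hR.1 j).measurableSet u hu))
      (fun u hu v hv hne => ((hR.1 j).pairwise_disjoint hu hv hne).preimage σ)
      (fun ω => (hR.1 j).exists_mem_absOf (σ ω)) fun u hu ω hω => ?_
    have e1 := horo_mul (ξ := ξ) (1 : J.HierO act) g b ω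
    have e2 := horo_mul (ξ := ξ) g⁻¹ g ξ ω
    have e3 : horo ξ (g⁻¹ * g) ξ ω = 0 := by
      rw [inv_mul_cancel]
      exact horo_eq_zero_of_toHier_eq_one hR hperfect hfinite (map_one _) ω
    rw [one_mul] at e1
    rw [← hF u hu _ hω, ← hw u hu _ hω, ← Real.rpow_add lam.2.1, pseudoderiv_eq_neg_horo, e1,
      ← hσ]
    congr 1
    rw [← hσ] at e2
    linarith
  rw [hpre]
  refine Finset.sum_congr rfl fun u hu => ?_
  rw [hT u hu]
  ring

/-! ### Weak characterization of the vectors `Ψ[μ]` -/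

lemma inner_psi_psi (μ : SignedMeasure J.Abs) {j : ℕ}
    {v : J.H lam}
    (h : ∀ b ∈ R j, inner ℝ v (J.e lam b) = inner ℝ (J.psi lam ξ μ (R j)) (J.e lam b)) :
    inner ℝ v (J.psi lam ξ μ (R j)) = ‖J.psi lam ξ μ (R j)‖ ^ 2 := by
  rw [← real_inner_self_eq_norm_sq]
  conv_lhs => rw [psi, inner_sum]
  conv_rhs => arg 3; rw [psi]
  rw [inner_sum]
  refine Finset.sum_congr rfl fun u hu => ?_
  rw [f, real_inner_smul_right, real_inner_smul_right, real_inner_smul_right,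
    real_inner_smul_right, h u (mem_bdry.1 hu).1]

/-- For `i ≤ j` the difference `Ψ[μ|R j] - Ψ[μ|R i]` is orthogonal to `Ψ[μ|R i]`. -/
lemma IsExhaustion.inner_psi_of_le (hR : J.IsExhaustion ξ R) (μ : SignedMeasure J.Abs) {i j : ℕ}
    (hij : i ≤ j) : inner ℝ (J.psi lam ξ μ (R j)) (J.psi lam ξ μ (R i)) =
      ‖J.psi lam ξ μ (R i)‖ ^ 2 := by
  refine inner_psi_psi μ fun b hb => ?_
  -- `horo` of the identity serves for any acting group; here the trivial one
  rw [(hR.1 i).inner_psi (1 : Unit →* J.Aut) hb,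
    (hR.1 j).inner_psi (1 : Unit →* J.Aut) (hR.2.1 hij hb)]

lemma IsExhaustion.norm_sub_sq (hR : J.IsExhaustion ξ R) (μ : SignedMeasure J.Abs) {i j : ℕ}
    (hij : i ≤ j) : ‖J.psi lam ξ μ (R j) - J.psi lam ξ μ (R i)‖ ^ 2 =
      ‖J.psi lam ξ μ (R j)‖ ^ 2 - ‖J.psi lam ξ μ (R i)‖ ^ 2 := by
  rw [norm_sub_sq_real, hR.inner_psi_of_le μ hij]
  ring

lemma IsExhaustion.exists_isPsi (hR : J.IsExhaustion ξ R) {μ : SignedMeasure J.Abs}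
    (hμ : J.MemE lam ξ R μ) : ∃ v, J.IsPsi lam ξ R μ v := by
  obtain ⟨L, hL⟩ := hμ
  refine cauchySeq_tendsto_of_complete (Metric.cauchySeq_iff'.2 fun ε hε => ?_)
  have hsq := (hL.pow 2).cauchySeq
  obtain ⟨N, hN⟩ := Metric.cauchySeq_iff'.1 hsq (ε ^ 2) (by positivity)
  refine ⟨N, fun n hn => ?_⟩
  have h1 := hN n hn
  rw [Real.dist_eq, ← hR.norm_sub_sq μ hn, abs_of_nonneg (by positivity)] at h1
  rw [dist_eq_norm]
  exact (sq_lt_sq₀ (norm_nonneg _) hε.le).1 h1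

lemma IsPsi.memE {μ : SignedMeasure J.Abs} {v : J.H lam} (h : J.IsPsi lam ξ R μ v) :
    J.MemE lam ξ R μ := ⟨‖v‖, h.norm⟩

variable (act) in
lemma IsPsi.inner_e (hR : J.IsExhaustion ξ R) {μ : SignedMeasure J.Abs} {v : J.H lam}
    (h : J.IsPsi lam ξ R μ v) (b : V) : inner ℝ v (J.e lam b) =
      chargeIntegral μ fun ω => (lam : ℝ) ^ horo ξ (1 : J.HierO act) b ω := by
  refine tendsto_nhds_unique (h.inner tendsto_const_nhds) ?_
  refine tendsto_const_nhds.congr' ?_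
  filter_upwards [hR.eventually_mem b] with j hj
  exact ((hR.1 j).inner_psi act hj μ).symm

lemma eq_of_inner_e {v w : J.H lam}
    (h : ∀ b, inner ℝ v (J.e lam b) = inner ℝ w (J.e lam b)) : v = w := by
  refine ext_inner_right ℝ fun x => ?_
  have := (innerSL ℝ v).ext_on (g := innerSL ℝ w) (J.span_e lam) (by
    rintro _ ⟨b, rfl⟩
    exact h b)
  exact congrArg (fun A : J.H lam →L[ℝ] ℝ => A x) this

/-- A vector whose scalar products with all `e b` are the limits of those of `Ψ[μ|R j]` bounds the
norms of `Ψ[μ|R j]`, hence it is the limit. -/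
lemma isPsi_of_inner_e (hR : J.IsExhaustion ξ R) {μ : SignedMeasure J.Abs} {v : J.H lam}
    (h : ∀ b, inner ℝ v (J.e lam b) =
      chargeIntegral μ fun ω => (lam : ℝ) ^ horo ξ (1 : J.HierO act) b ω) :
    J.IsPsi lam ξ R μ v := by
  have hle : ∀ x y : J.H lam, inner ℝ x y = ‖y‖ ^ 2 → ‖y‖ ≤ ‖x‖ := by
    intro x y hxy
    rcases (norm_nonneg y).eq_or_lt with h0 | h0
    · exact h0 ▸ norm_nonneg x
    · have h1 := real_inner_le_norm x y
      rw [hxy, sq] at h1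
      exact le_of_mul_le_mul_right h1 h0
  have hmono : Monotone fun j => ‖J.psi lam ξ μ (R j)‖ := fun i j hij =>
    hle _ _ (hR.inner_psi_of_le μ hij)
  have hbdd : BddAbove (range fun j => ‖J.psi lam ξ μ (R j)‖) := by
    refine ⟨‖v‖, ?_⟩
    rintro _ ⟨j, rfl⟩
    exact hle _ _ (inner_psi_psi μ fun b hb => by rw [h b, (hR.1 j).inner_psi act hb])
  obtain ⟨w, hw⟩ := hR.exists_isPsi ⟨_, tendsto_atTop_ciSup hmono hbdd⟩
  rwa [eq_of_inner_e fun b => (h b).trans (hw.inner_e act hR b).symm]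

lemma IsPsi.repU (hR : J.IsExhaustion ξ R) (hperfect : J.IsPerfect) (hfinite : J.IsLocallyFinite)
    {μ : SignedMeasure J.Abs} {v : J.H lam} (h : J.IsPsi lam ξ R μ v) (g : J.HierO act) :
    J.IsPsi lam ξ R (J.T act lam ξ g μ) (repU act lam g v) := by
  refine isPsi_of_inner_e (act := act) hR fun b => ?_
  rw [chargeIntegral_T hR hperfect hfinite]
  refine tendsto_nhds_unique
    ((((MetricTree.repU act lam g).continuous.tendsto v).comp h).inner tendsto_const_nhds) ?_
  refine tendsto_const_nhds.congr' ?_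
  filter_upwards [hR.eventually_horo_eq hperfect hfinite g b] with j hj
  exact ((hR.1 j).inner_repU_psi g b μ hj).symm

end MetricTree

end

/-- Let `J` be a locally finite perfect metric tree, on which `Γ` acts by isometries. The
hierarchomorphisms `g` act in the Hilbert space by bounded operators `U g` with
`U g (e a) = e (g a)`. (a) These operators preserve the closure of the boundary space. (b) The
restriction of `U g` to it depends only on the map of the absolute induced by `g`; so does the
pseudoderivative. (c) For a measure `μ` in the boundary space, `U g (Ψ[μ]) = Ψ[T(g) μ]`, where
`T(g)` is the weighted image of measures; equivalently, `U(g⁻¹)` corresponds to the passage to the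
measure `lam ^ n(g, ω) · μ(g ω)`. -/
theorem proposition6p1 {V Γ : Type*} [Group Γ] (J : MetricTree V) (hperfect : J.IsPerfect)
    (hfinite : J.IsLocallyFinite) (act : Γ →* J.Aut) (lam : Set.Ioo (0 : ℝ) 1) (ξ : V)
    (R : ℕ → Finset V) (hR : J.IsExhaustion ξ R) :
    ∃ U : J.HierO act →* (J.H lam →L[ℝ] J.H lam),
      (∀ (g : J.HierO act) (a : V), U g (J.e lam a) = J.e lam ((g : Equiv.Perm V) a)) ∧
      (∀ g : J.HierO act, ∀ v ∈ closure (J.boundaryImage lam ξ R),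
        U g v ∈ closure (J.boundaryImage lam ξ R)) ∧
      (∀ g h : J.HierO act, J.toHier act g = J.toHier act h →
        (∀ v ∈ closure (J.boundaryImage lam ξ R), U g v = U h v) ∧
        J.pseudoderiv act ξ g = J.pseudoderiv act ξ h) ∧
      (∀ (g : J.HierO act) (μ : MeasureTheory.SignedMeasure J.Abs), J.MemE lam ξ R μ →
        J.MemE lam ξ R (J.T act lam ξ g μ) ∧
        ∃ v, J.IsPsi lam ξ R μ v ∧ J.IsPsi lam ξ R (J.T act lam ξ g μ) (U g v)) ∧
      (∀ (g : J.HierO act) (μ : MeasureTheory.SignedMeasure J.Abs),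
        J.T act lam ξ g⁻¹ μ = J.weightedImage (J.toHier act g)⁻¹
          (fun ω => (lam : ℝ) ^ J.pseudoderiv act ξ g ω) μ) := by
  refine ⟨MetricTree.repU act lam, MetricTree.repU_e lam, ?_, ?_, ?_, ?_⟩
  · intro g v hv
    refine map_mem_closure (MetricTree.repU act lam g).continuous hv ?_
    rintro w ⟨μ, -, hw⟩
    have := hw.repU hR hperfect hfinite g
    exact ⟨_, this.memE, this⟩
  · intro g h hgh
    refine ⟨fun v hv => ?_, MetricTree.pseudoderiv_eq_of_toHier_eq hR hperfect hfinite hgh⟩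
    have hT : ∀ μ, J.T act lam ξ g μ = J.T act lam ξ h μ := by
      intro μ
      have hinv : J.toHier act g⁻¹ = J.toHier act h⁻¹ := by rw [map_inv, map_inv, hgh]
      rw [MetricTree.T, MetricTree.T, hgh,
        MetricTree.pseudoderiv_eq_of_toHier_eq hR hperfect hfinite hinv]
    have hcl : IsClosed {v | MetricTree.repU act lam g v = MetricTree.repU act lam h v} :=
      isClosed_eq (MetricTree.repU act lam g).continuous (MetricTree.repU act lam h).continuous
    refine closure_minimal ?_ hcl hv
    rintro w ⟨μ, -, hw⟩
    have h1 := hw.repU hR hperfect hfinite g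
    rw [hT] at h1
    exact tendsto_nhds_unique h1 (hw.repU hR hperfect hfinite h)
  · intro g μ hμ
    obtain ⟨v, hv⟩ := hR.exists_isPsi hμ
    have := hv.repU hR hperfect hfinite g
    exact ⟨this.memE, v, hv, this⟩
  · intro g μ
    rw [MetricTree.T, map_inv, inv_inv]
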